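/- Let $M$ be a connected closed orientable 3-manifold (of class $C^1$ at least) and let $f^t\colon M\to M$ be a non-singular Morse-Smale flow (NMS-flow): a $C^1$ flow without fixed points whose nonwandering set consists of finitely many hyperbolic periodic orbits, and such that the stable and unstable manifolds of its periodic orbits intersect transversally. The multipliers of a periodic orbit $\mathcal O$ of least period $T$ through $p$ are the two eigenvalues of its linearized Poincaré return map, i.e. the eigenvalues of $Df^T_p$ on $T_pM$ with the trivial eigenvalue $1$ of the flow direction removed once; a hyperbolic periodic orbit (no multiplier of absolute value $1$) is attracting if both multipliers are less than $1$ in absolute value, repelling if both are greater than $1$ in absolute value, and a saddle otherwise; a saddle is twisted if both its multipliers are negative. Suppose that $f^t$ has exactly one saddle periodic orbit and that this orbit is twisted. Then the nonwandering set of $f^t$ consists of exactly three periodic orbits $S,A,R$, which are saddle, attracting and repelling, respectively: $S,A,R$ are pairwise distinct, they are all the periodic orbits of $f^t$, and the nonwandering set equals $S\cup A\cup R$. -/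

import Mathlib

open Set Filter Topology
open scoped Manifold ContDiff

noncomputable section

/-- The model space of a 3-manifold without boundary. -/
abbrev E3 : Type := EuclideanSpace ℝ (Fin 3)

/-- A `C^1` 3-manifold is orientable if it has an atlas of charts, compatible with its
differentiable structure, whose transition maps all have positive Jacobian determinant. -/
def IsOrientable3 (M : Type*) [TopologicalSpace M] [ChartedSpace E3 M] : Prop :=
  ∃ A : Set (OpenPartialHomeomorph M E3),
    A ⊆ IsManifold.maximalAtlas (𝓡 3) 1 M ∧
    (∀ x : M, ∃ e ∈ A, x ∈ e.source) ∧
    ∀ e ∈ A, ∀ e' ∈ A, ∀ x ∈ e.source ∩ e'.source,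
      0 < (fderiv ℝ (fun y : E3 => e' (e.symm y)) (e x)).det

section TopologicalDynamics

variable {M : Type*} [TopologicalSpace M]

/-- The set of nonwandering points: every neighbourhood `U` of `x` meets some `f^t(U)` with `t`
arbitrarily large. -/
def nonwanderingSet (f : Flow ℝ M) : Set M :=
  {x | ∀ U ∈ 𝓝 x, ∀ t₀ : ℝ, ∃ t, t₀ ≤ t ∧ (f t '' U ∩ U).Nonempty}

/-- `O` is the orbit of the point `p`, which is periodic with least positive period `T`.
(A fixed point has no least positive period, hence is not periodic in this sense.) -/
def IsPeriodicOrbitAt (f : Flow ℝ M) (O : Set M) (p : M) (T : ℝ) : Prop :=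
  IsLeast {t : ℝ | 0 < t ∧ f t p = p} T ∧ O = range fun t : ℝ => f t p

/-- `O` is a (nonconstant) periodic orbit of the flow. -/
def IsPeriodicOrbit (f : Flow ℝ M) (O : Set M) : Prop :=
  ∃ p T, IsPeriodicOrbitAt f O p T

/-- `W^s_O`: the points whose forward trajectory converges to the set `O`. -/
def stableManifold (f : Flow ℝ M) (O : Set M) : Set M :=
  {x | Tendsto (fun t : ℝ => f t x) atTop (𝓝ˢ O)}

/-- `W^u_O`: the points whose backward trajectory converges to the set `O`. -/
def unstableManifold (f : Flow ℝ M) (O : Set M) : Set M :=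
  {x | Tendsto (fun t : ℝ => f t x) atBot (𝓝ˢ O)}

end TopologicalDynamics

section SmoothDynamics

variable {M : Type*} [TopologicalSpace M] [ChartedSpace E3 M]

/-- The flow is of class `C^1`, jointly in time and space. -/
def IsC1Flow (f : Flow ℝ M) : Prop :=
  ContMDiff (𝓘(ℝ, ℝ).prod (𝓡 3)) (𝓡 3) 1 (fun q : ℝ × M => f q.1 q.2)

/-- The differential at `p` of the time-`T` map. It is used only when `f T p = p`, so that the
source and the target are the same tangent space `T_p M` (which is `E3` as a vector space). -/
def returnDifferential (f : Flow ℝ M) (p : M) (T : ℝ) : E3 →ₗ[ℝ] E3 :=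
  let L : E3 →L[ℝ] E3 := mfderiv (𝓡 3) (𝓡 3) (f T) p
  L.toLinearMap

/-- The multipliers of a periodic point `p` of least period `T`: the two complex eigenvalues,
with multiplicity, of the linearised Poincaré return map, that is, the eigenvalues of the
differential of `f^T` on `T_p M` with the trivial eigenvalue `1` (that of the direction
of the flow) removed once. -/
def multipliers (f : Flow ℝ M) (p : M) (T : ℝ) : Multiset ℂ :=
  (((returnDifferential f p T).charpoly.map (algebraMap ℝ ℂ)).roots).erase 1

/-- A periodic orbit is hyperbolic if no multiplier has absolute value one. -/
def IsHyperbolicOrbit (f : Flow ℝ M) (O : Set M) : Prop :=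
  ∃ p T, IsPeriodicOrbitAt f O p T ∧ ∀ z ∈ multipliers f p T, ‖z‖ ≠ 1

/-- Attracting periodic orbit: both multipliers are less than one in absolute value. -/
def IsAttractingOrbit (f : Flow ℝ M) (O : Set M) : Prop :=
  ∃ p T, IsPeriodicOrbitAt f O p T ∧ ∀ z ∈ multipliers f p T, ‖z‖ < 1

/-- Repelling periodic orbit: both multipliers are greater than one in absolute value. -/
def IsRepellingOrbit (f : Flow ℝ M) (O : Set M) : Prop :=
  ∃ p T, IsPeriodicOrbitAt f O p T ∧ ∀ z ∈ multipliers f p T, 1 < ‖z‖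

/-- Saddle periodic orbit: one multiplier is less than one and the other is greater than one in
absolute value. -/
def IsSaddleOrbit (f : Flow ℝ M) (O : Set M) : Prop :=
  ∃ p T, IsPeriodicOrbitAt f O p T ∧
    (∃ z ∈ multipliers f p T, ‖z‖ < 1) ∧ (∃ z ∈ multipliers f p T, 1 < ‖z‖)

/-- Twisted saddle periodic orbit: moreover, both multipliers are negative real numbers. -/
def IsTwistedSaddleOrbit (f : Flow ℝ M) (O : Set M) : Prop :=
  ∃ p T, IsPeriodicOrbitAt f O p T ∧
    (∃ z ∈ multipliers f p T, ‖z‖ < 1) ∧ (∃ z ∈ multipliers f p T, 1 < ‖z‖) ∧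
    ∀ z ∈ multipliers f p T, z.im = 0 ∧ z.re < 0

/-- The vectors tangent at `x` to the immersed submanifold `W^s_O`: the velocities of the `C^1`
curves through `x` which are attracted to `O` uniformly. Uniformity says that some `f^t` takes the
whole curve into the local stable manifold, i.e. that the curve is continuous in the topology of
the immersed manifold `W^s_O`, which may be finer than the one induced from `M`. -/
def stableTangent (f : Flow ℝ M) (O : Set M) (x : M) : Set (TangentSpace (𝓡 3) x) :=
  {v | ∃ γ : ℝ → M, ContMDiff 𝓘(ℝ, ℝ) (𝓡 3) 1 γ ∧ γ 0 = x ∧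
    (mfderiv 𝓘(ℝ, ℝ) (𝓡 3) γ 0 (1 : ℝ) : E3) = (v : E3) ∧
    ∀ U ∈ 𝓝ˢ O, ∀ᶠ t : ℝ in atTop, ∀ s, f t (γ s) ∈ U}

/-- The vectors tangent at `x` to the immersed submanifold `W^u_O`. -/
def unstableTangent (f : Flow ℝ M) (O : Set M) (x : M) : Set (TangentSpace (𝓡 3) x) :=
  {v | ∃ γ : ℝ → M, ContMDiff 𝓘(ℝ, ℝ) (𝓡 3) 1 γ ∧ γ 0 = x ∧
    (mfderiv 𝓘(ℝ, ℝ) (𝓡 3) γ 0 (1 : ℝ) : E3) = (v : E3) ∧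
    ∀ U ∈ 𝓝ˢ O, ∀ᶠ t : ℝ in atBot, ∀ s, f t (γ s) ∈ U}

/-- NMS-flow: a `C^1` flow without fixed points which is Morse-Smale, i.e. its nonwandering set
consists of finitely many hyperbolic periodic orbits, whose stable and unstable manifolds
intersect transversally. -/
structure IsNMSFlow (f : Flow ℝ M) : Prop where
  contMDiff : IsC1Flow f
  nonsingular : ∀ x : M, ∃ t : ℝ, f t x ≠ x
  finite_hyperbolic : ∃ P : Set (Set M), P.Finite ∧ (∀ O ∈ P, IsHyperbolicOrbit f O) ∧
    nonwanderingSet f = ⋃₀ P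
  transversal : ∀ O O' : Set M, IsPeriodicOrbit f O → IsPeriodicOrbit f O' →
    ∀ x ∈ stableManifold f O ∩ unstableManifold f O', ∀ w : TangentSpace (𝓡 3) x,
      ∃ v ∈ stableTangent f O x, ∃ u ∈ unstableTangent f O' x, w = v + u

/-- The class `G_3^-(M)`: NMS-flows with a unique saddle periodic orbit, which is twisted. -/
structure IsG3MinusFlow (f : Flow ℝ M) : Prop where
  nms : IsNMSFlow f
  unique_saddle : ∃! S : Set M, IsSaddleOrbit f S
  twisted : ∀ S : Set M, IsSaddleOrbit f S → IsTwistedSaddleOrbit f S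

end SmoothDynamics

end

/-! The nonwandering set is a finite union of periodic orbits and `M` is compact, so every
trajectory converges to exactly one of these orbits
(`IsOrbitDecomposition.exists_mem_stableManifold`), and `M` is the disjoint union of their stable
manifolds. Besides the saddle `S`, each orbit is either a sink, whose stable manifold is open, or a
source, whose stable manifold is the orbit itself.

The twist enters near `S`. On a cross-section, the return map has derivative `diag(a, b)` with `-1 <
a < 0` and `b < -1`, so it exchanges the two sides of the local stable manifold. Points off the
local stable manifold and close to `S` lie in basins of sinks: otherwise exit points of nearby
trajectories would accumulate at a point of the section other than the base point which is
homoclinic to `S`, or in a sink basin disjoint from the stable manifold of `S`, or on a source. The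
first and last would be nonwandering, although the section meets the nonwandering set only at its
base point. Each side is connected, hence in a single basin, and the return map carries one side
into the other, so both are in the same basin, that of some `A`
(`IsFlowSection.exists_unique_basin`).

Hence the union `U` of the stable manifolds of `S` and `A` is open, and so is the union `V` of the
remaining sink basins. The sources cannot separate `U` from `V`, because a punctured cross-section
is connected. As `M` is connected and `U` is nonempty, `V` is empty, and `A` is the only sink
(`IsOrbitDecomposition.sinks_eq_singleton`). Time reversal preserves the hypotheses of this argument
and exchanges sinks with sources, so there is also a unique source. -/

/-! ### Cone dynamics of a planar saddle with negative multipliers -/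

/-- Global cone conditions for a planar map close to `diag(λ, μ)` with `|λ| < 1`, `μ < -1`:
`l` bounds the horizontal contraction, `m` the vertical expansion, `K` the Lipschitz constant. -/
structure FlipSaddle (H : ℝ × ℝ → ℝ × ℝ) (l m K : ℝ) : Prop where
  l_nonneg : 0 ≤ l
  l_lt : l < 1
  lt_m : 1 < m
  one_le_K : 1 ≤ K
  zero : H 0 = 0
  lip : ∀ z w, ‖H z - H w‖ ≤ K * ‖z - w‖
  contr : ∀ z w, |(H z).1 - (H w).1| ≤ l * max |z.1 - w.1| |z.2 - w.2|
  flip : ∀ z w, |z.1 - w.1| ≤ z.2 - w.2 → m * (z.2 - w.2) ≤ (H w).2 - (H z).2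

namespace FlipSaddle

variable {H : ℝ × ℝ → ℝ × ℝ} {l m K : ℝ}

theorem continuous (h : FlipSaddle H l m K) : Continuous H := by
  have : LipschitzWith (Real.toNNReal K) H := by
    refine LipschitzWith.of_dist_le_mul fun z w => ?_
    rw [dist_eq_norm, dist_eq_norm, Real.coe_toNNReal _ (by linarith [h.one_le_K])]
    exact h.lip z w
  exact this.continuous

theorem iterate_zero (h : FlipSaddle H l m K) (n : ℕ) : H^[n] 0 = 0 :=
  Function.iterate_fixed h.zero n

theorem norm_iterate_le (h : FlipSaddle H l m K) (n : ℕ) (z : ℝ × ℝ) :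
    ‖H^[n] z‖ ≤ K ^ n * ‖z‖ := by
  induction n with
  | zero => simp
  | succ n ih =>
    rw [Function.iterate_succ_apply']
    have := h.lip (H^[n] z) 0
    rw [h.zero, sub_zero, sub_zero] at this
    calc _ ≤ K * ‖H^[n] z‖ := this
      _ ≤ K * (K ^ n * ‖z‖) := by gcongr; linarith [h.one_le_K]
      _ = _ := by ring

/-- A difference in the vertical cone stays there, flips its sign and expands. -/
theorem flip_signed (h : FlipSaddle H l m K) {s : ℝ} (hs : s = 1 ∨ s = -1) {z w : ℝ × ℝ}
    (hv : |z.1 - w.1| ≤ s * (z.2 - w.2)) :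
    m * (s * (z.2 - w.2)) ≤ -s * ((H z).2 - (H w).2) ∧
      |(H z).1 - (H w).1| ≤ l * (s * (z.2 - w.2)) := by
  have h0 : 0 ≤ s * (z.2 - w.2) := (abs_nonneg _).trans hv
  have habs : |z.2 - w.2| = s * (z.2 - w.2) := by
    rcases hs with rfl | rfl
    · rw [abs_of_nonneg (by linarith)]; ring
    · rw [abs_of_nonpos (by linarith)]; ring
  refine ⟨?_, ?_⟩
  · rcases hs with rfl | rfl
    · have := h.flip z w (by linarith)
      linarith
    · have := h.flip w z (by rw [abs_sub_comm]; linarith)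
      linarith
  · have := h.contr z w
    rwa [habs, max_eq_right hv] at this

theorem sign_pow {s : ℝ} (hs : s = 1 ∨ s = -1) (n : ℕ) :
    s * (-1) ^ n = 1 ∨ s * (-1) ^ n = -1 := by
  rcases neg_one_pow_eq_or ℝ n with h | h <;> rcases hs with rfl | rfl <;> simp [h]

/-- Each application of `H` preserves the vertical cone and reverses its orientation, so the factor
`(-1) ^ n` keeps the signed height positive while the expansion by `m` accumulates. -/
theorem iterate_vertical (h : FlipSaddle H l m K) {s : ℝ} (hs : s = 1 ∨ s = -1) {z w : ℝ × ℝ}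
    (hv : |z.1 - w.1| ≤ s * (z.2 - w.2)) (n : ℕ) :
    |(H^[n] z).1 - (H^[n] w).1| ≤ s * (-1) ^ n * ((H^[n] z).2 - (H^[n] w).2) ∧
      m ^ n * (s * (z.2 - w.2)) ≤ s * (-1) ^ n * ((H^[n] z).2 - (H^[n] w).2) := by
  induction n with
  | zero => simpa using hv
  | succ n ih =>
    obtain ⟨ih1, ih2⟩ := ih
    have h0 := (abs_nonneg _).trans ih1
    obtain ⟨h1, h2⟩ := h.flip_signed (sign_pow hs n) ih1
    rw [Function.iterate_succ_apply', Function.iterate_succ_apply']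
    have e : s * (-1) ^ (n + 1) = -(s * (-1) ^ n) := by ring
    rw [e]
    have hl := h.l_lt
    have hm := h.lt_m
    refine ⟨h2.trans (le_trans ?_ h1), le_trans ?_ h1⟩
    · gcongr; linarith
    · rw [pow_succ, mul_comm _ m, mul_assoc]
      gcongr

/-- Differences which are horizontal at time `n` have been contracted up to then. -/
theorem iterate_horizontal (h : FlipSaddle H l m K) {z w : ℝ × ℝ} (n : ℕ)
    (hh : |(H^[n] z).2 - (H^[n] w).2| ≤ |(H^[n] z).1 - (H^[n] w).1|) :
    |(H^[n] z).1 - (H^[n] w).1| ≤ l ^ n * |z.1 - w.1| := by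
  induction n with
  | zero => simp
  | succ n ih =>
    rw [Function.iterate_succ_apply', Function.iterate_succ_apply'] at hh ⊢
    set a := H^[n] z
    set b := H^[n] w
    rcases le_or_gt |a.2 - b.2| |a.1 - b.1| with hc | hc
    · have := h.contr a b
      rw [max_eq_left hc] at this
      calc _ ≤ _ := this
        _ ≤ l * (l ^ n * |z.1 - w.1|) := by
          gcongr
          · exact h.l_nonneg
          · exact ih hc
        _ = _ := by ring
    -- A difference in the open vertical cone is mapped to a difference with vertical part strictly
    -- larger than the horizontal one, contrary to `hh`. Thus horizontality at time `n + 1` forces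
    -- horizontality at time `n`.
    · exfalso
      have key : ∀ s : ℝ, (s = 1 ∨ s = -1) → |a.2 - b.2| = s * (a.2 - b.2) → False := by
        intro s hs he
        obtain ⟨h1, h2⟩ := h.flip_signed hs (z := a) (w := b) (by rw [← he]; exact hc.le)
        have h3 : -s * ((H a).2 - (H b).2) ≤ |(H a).2 - (H b).2| := by
          rcases hs with rfl | rfl
          · rw [neg_one_mul]; exact neg_le_abs _
          · rw [neg_neg, one_mul]; exact le_abs_self _
        have hp : 0 < s * (a.2 - b.2) := by rw [← he]; exact (abs_nonneg _).trans_lt hc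
        have := h.l_lt
        have := h.lt_m
        nlinarith
      rcases abs_cases (a.2 - b.2) with h1 | h1
      · exact key 1 (Or.inl rfl) (by linarith)
      · exact key (-1) (Or.inr rfl) (by linarith)

end FlipSaddle

/-- The points whose forward `H`-orbit enters the vertical cone, on the side `s = ±1`. -/
def coneEntering (H : ℝ × ℝ → ℝ × ℝ) (s : ℝ) : Set (ℝ × ℝ) :=
  {z | ∃ k : ℕ, |(H^[k] z).1| < s * (-1) ^ k * (H^[k] z).2}

/-- The points whose forward `H`-orbit stays in the horizontal cone. -/
def coneAvoiding (H : ℝ × ℝ → ℝ × ℝ) : Set (ℝ × ℝ) :=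
  {z | ∀ k : ℕ, |(H^[k] z).2| ≤ |(H^[k] z).1|}

theorem mem_cone_trichotomy (H : ℝ × ℝ → ℝ × ℝ) (z : ℝ × ℝ) :
    z ∈ coneAvoiding H ∨ z ∈ coneEntering H 1 ∨ z ∈ coneEntering H (-1) := by
  by_cases hz : z ∈ coneAvoiding H
  · exact Or.inl hz
  · right
    simp only [coneAvoiding, mem_ofPred_eq, not_forall, not_le] at hz
    obtain ⟨k, hk⟩ := hz
    have : |(H^[k] z).2| = 1 * (-1) ^ k * (H^[k] z).2 ∨
        |(H^[k] z).2| = -1 * (-1) ^ k * (H^[k] z).2 := by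
      rcases neg_one_pow_eq_or ℝ k with h | h <;> rcases abs_choice (H^[k] z).2 with h' | h' <;>
        simp [h, h']
    rcases this with h | h
    · exact Or.inl ⟨k, h ▸ hk⟩
    · exact Or.inr ⟨k, h ▸ hk⟩

namespace FlipSaddle

variable {H : ℝ × ℝ → ℝ × ℝ} {l m K : ℝ}

/-- After `k` steps the difference `w - z` is in the cone on the same side as the iterate of `z`,
and this cone is closed under addition. The vertical rays obtained in this way are what makes each
side connected. -/
theorem coneEntering_above (h : FlipSaddle H l m K) {s : ℝ} (hs : s = 1 ∨ s = -1) {z w : ℝ × ℝ}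
    (hz : z ∈ coneEntering H s) (h1 : w.1 = z.1) (h2 : s * z.2 ≤ s * w.2) :
    w ∈ coneEntering H s := by
  obtain ⟨k, hk⟩ := hz
  refine ⟨k, ?_⟩
  have hv : |w.1 - z.1| ≤ s * (w.2 - z.2) := by
    rw [h1, sub_self, abs_zero]; linarith
  have := (h.iterate_vertical hs hv k).1
  have h3 := abs_sub_abs_le_abs_sub (H^[k] w).1 (H^[k] z).1
  linarith

/-- This is where the twist acts: the sides are labelled by the orientation at time `0`, and one
application of `H` shifts the alternation by one step, so the two sides are exchanged. -/
theorem coneEntering_map (h : FlipSaddle H l m K) {s : ℝ} (hs : s = 1 ∨ s = -1) {z : ℝ × ℝ}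
    (hz : z ∈ coneEntering H s) : H z ∈ coneEntering H (-s) := by
  have step : ∀ k : ℕ, |(H^[k] z).1| < s * (-1) ^ k * (H^[k] z).2 → H z ∈ coneEntering H (-s) := by
    intro k hk
    refine ⟨k, ?_⟩
    obtain ⟨h1, h2⟩ := h.flip_signed (sign_pow hs k) (z := H^[k] z) (w := 0) (by simpa using hk.le)
    rw [h.zero] at h1 h2
    simp only [Prod.snd_zero, Prod.fst_zero, sub_zero] at h1 h2
    rw [← Function.iterate_succ_apply, Function.iterate_succ_apply']
    have hp := (abs_nonneg _).trans_lt hk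
    have := h.l_lt
    have := h.lt_m
    nlinarith
  obtain ⟨k, hk⟩ := hz
  exact step k hk

theorem escape (h : FlipSaddle H l m K) {s : ℝ} (hs : s = 1 ∨ s = -1) {z : ℝ × ℝ}
    (hz : z ∈ coneEntering H s) (C : ℝ) : ∃ n : ℕ, C < ‖H^[n] z‖ := by
  obtain ⟨k, hk⟩ := hz
  have hp := (abs_nonneg _).trans_lt hk
  obtain ⟨n, hn⟩ := pow_unbounded_of_one_lt (C / (s * (-1) ^ k * (H^[k] z).2)) h.lt_m
  rw [div_lt_iff₀ hp] at hn
  have := (h.iterate_vertical (sign_pow hs k) (z := H^[k] z) (w := 0) (by simpa using hk.le) n).2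
  rw [h.iterate_zero] at this
  simp only [Prod.snd_zero, sub_zero] at this
  refine ⟨n + k, ?_⟩
  rw [Function.iterate_add_apply]
  refine (hn.trans_le this).trans_le ?_
  refine le_trans ?_ (norm_snd_le _)
  rcases sign_pow (sign_pow hs k) n with e | e <;> rw [e, Real.norm_eq_abs]
  · rw [one_mul]; exact le_abs_self _
  · rw [neg_one_mul]; exact neg_le_abs _

/-- In the horizontal cone the sup norm is the horizontal coordinate, which is contracted. So an
orbit that never enters the vertical cone tends to `0`: `coneAvoiding` is contained in the stable
set of `0`. -/
theorem norm_le_of_coneAvoiding (h : FlipSaddle H l m K) {z : ℝ × ℝ} (hz : z ∈ coneAvoiding H)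
    (k : ℕ) : ‖H^[k] z‖ ≤ l ^ k * ‖z‖ := by
  have := h.iterate_horizontal (z := z) (w := 0) k (by simpa [h.iterate_zero] using hz k)
  rw [h.iterate_zero] at this
  simp only [Prod.fst_zero, sub_zero] at this
  rw [Prod.norm_def, Real.norm_eq_abs, Real.norm_eq_abs, max_eq_left (hz k)]
  exact this.trans (mul_le_mul_of_nonneg_left (norm_fst_le z) (pow_nonneg h.l_nonneg k))

/-- The part `C` in the cone itself is convex. From any other point a vertical segment, inside the
set by `coneEntering_above`, leads into `C`; it stays in the ball because balls of the sup norm are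
squares. -/
theorem isPreconnected_coneEntering_inter_ball (h : FlipSaddle H l m K) {s : ℝ}
    (hs : s = 1 ∨ s = -1) {r : ℝ} (hr : 0 < r) :
    IsPreconnected (coneEntering H s ∩ Metric.ball 0 r) := by
  have hball : ∀ z : ℝ × ℝ, z ∈ Metric.ball (0 : ℝ × ℝ) r ↔ |z.1| < r ∧ |z.2| < r := by
    intro z
    rw [mem_ball_zero_iff, Prod.norm_def, max_lt_iff, Real.norm_eq_abs, Real.norm_eq_abs]
  have hss : s * s = 1 := by rcases hs with rfl | rfl <;> norm_num
  have habs : |s| = 1 := by rcases hs with rfl | rfl <;> simp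
  set C : Set (ℝ × ℝ) := {z | |z.1| < s * z.2} ∩ Metric.ball 0 r
  have hCconv : Convex ℝ C := by
    refine Convex.inter ?_ (convex_ball _ _)
    have : ConvexOn ℝ univ fun z : ℝ × ℝ => |z.1| - s * z.2 := by
      refine ConvexOn.sub ?_ ?_
      · exact (convexOn_norm (convex_univ (𝕜 := ℝ) (E := ℝ))).comp_linearMap (LinearMap.fst ℝ ℝ ℝ)
      · exact ((s • LinearMap.snd ℝ ℝ ℝ).concaveOn convex_univ)
    simpa [sub_neg] using this.convex_lt 0
  have hCsub : C ⊆ coneEntering H s ∩ Metric.ball 0 r :=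
    fun z hz => ⟨⟨0, by simpa using hz.1⟩, hz.2⟩
  have base : ((0 : ℝ), s * (r / 2)) ∈ C := by
    refine ⟨?_, (hball _).2 ⟨by simpa using hr, ?_⟩⟩
    · simp only [mem_ofPred_eq, abs_zero]; rw [← mul_assoc, hss]; linarith
    · simp only [abs_mul, habs, one_mul]; rw [abs_of_pos (by linarith)]; linarith
  refine isPreconnected_of_forall ((0 : ℝ), s * (r / 2)) fun z hz => ?_
  have hzb := (hball z).1 hz.2
  have hsz : s * z.2 < r := by
    refine lt_of_le_of_lt (le_abs_self _) ?_
    rw [abs_mul, habs, one_mul]; exact hzb.2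
  -- The top height `t` exceeds `|z.1|`, so the segment ends in the cone, and is less than `r`, so
  -- it stays in the square.
  set t : ℝ := max (s * z.2) ((|z.1| + r) / 2)
  have ht : t < r := max_lt hsz (by linarith [hzb.1])
  have ht1 : |z.1| < t := lt_of_lt_of_le (by linarith [hzb.1]) (le_max_right _ _)
  have ht0 : 0 ≤ t := (abs_nonneg _).trans ht1.le
  set V : Set (ℝ × ℝ) := (fun u : ℝ => (z.1, s * u)) '' Icc (s * z.2) t
  have hVp : IsPreconnected V := isPreconnected_Icc.image _ (by fun_prop)
  have hVsub : V ⊆ coneEntering H s ∩ Metric.ball 0 r := by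
    rintro _ ⟨u, hu, rfl⟩
    refine ⟨h.coneEntering_above hs hz.1 rfl ?_, (hball _).2 ⟨hzb.1, ?_⟩⟩
    · simp only; rw [← mul_assoc, hss, one_mul]; exact hu.1
    · simp only [abs_mul, habs, one_mul]
      rw [abs_lt]
      refine ⟨lt_of_lt_of_le ?_ hu.1, hu.2.trans_lt ht⟩
      have := neg_abs_le (s * z.2)
      rw [abs_mul, habs, one_mul] at this
      linarith [hzb.2]
  have hzV : z ∈ V := ⟨s * z.2, ⟨le_rfl, le_max_left _ _⟩, by
    simp only; rw [← mul_assoc, hss, one_mul]⟩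
  have htV : (z.1, s * t) ∈ V := ⟨t, ⟨le_max_left _ _, le_rfl⟩, rfl⟩
  have htC : (z.1, s * t) ∈ C := by
    refine ⟨?_, (hVsub htV).2⟩
    simp only [mem_ofPred_eq]; rw [← mul_assoc, hss, one_mul]; exact ht1
  exact ⟨C ∪ V, union_subset hCsub hVsub, Or.inl base, Or.inr hzV,
    IsPreconnected.union (z.1, s * t) htC htV hCconv.isPreconnected hVp⟩

/-- Images of a small vertical segment through `w` reach every height; the one at the height of
`e = H^n e₀` is close to `e`. -/
theorem exists_vertical_preimage (h : FlipSaddle H l m K) {n : ℕ} {w e₀ : ℝ × ℝ} {δ η : ℝ}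
    (hw : ∀ k ≤ n, ‖H^[k] w‖ ≤ δ) (he₀ : ‖e₀‖ ≤ δ) (he : ‖H^[n] e₀‖ ≤ δ) (hη : 0 ≤ η)
    (hn : 2 * δ ≤ m ^ n * η) :
    ∃ u : ℝ × ℝ, u.1 = w.1 ∧ |u.2 - w.2| ≤ η ∧ (∀ k ≤ n, ‖H^[k] u‖ ≤ 3 * δ) ∧
      ‖H^[n] u - H^[n] e₀‖ ≤ l ^ n * (4 * δ) := by
  set e := H^[n] e₀
  have hm1 := h.lt_m
  -- The sign makes the signed height of the image larger at the upper end than at the lower one. By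
  -- expansion the two ends lie at least `2 * δ` above and below the image of `w`, while `e` is
  -- within `2 * δ` of that height, so the intermediate value theorem applies.
  let g : ℝ → ℝ := fun a => (-1) ^ n * (H^[n] (w.1, w.2 + a)).2
  have hg : Continuous g := by
    have := h.continuous.iterate n
    fun_prop
  have hsq : ((-1 : ℝ) ^ n) * (-1) ^ n = 1 := by rw [← mul_pow]; simp
  have habs : ∀ x : ℝ, |(-1) ^ n * x| = |x| := fun x => by rw [abs_mul]; simp
  have hbd : |(-1) ^ n * e.2 - (-1) ^ n * (H^[n] w).2| ≤ 2 * δ := by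
    rw [← mul_sub, habs]
    have h1 : |e.2| ≤ δ := (norm_snd_le e).trans he
    have h2 : |(H^[n] w).2| ≤ δ := (norm_snd_le _).trans (hw n le_rfl)
    have := abs_sub e.2 (H^[n] w).2
    linarith
  rw [abs_le] at hbd
  have hup : (-1) ^ n * e.2 ≤ g η := by
    have := (h.iterate_vertical (s := 1) (Or.inl rfl) (z := (w.1, w.2 + η)) (w := w)
      (by simpa using hη) n).2
    simp only [one_mul, add_sub_cancel_left] at this
    change _ ≤ (-1) ^ n * (H^[n] (w.1, w.2 + η)).2
    linarith
  have hlo : g (-η) ≤ (-1) ^ n * e.2 := by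
    have := (h.iterate_vertical (s := 1) (Or.inl rfl) (w := (w.1, w.2 + -η)) (z := w)
      (by simpa using hη) n).2
    simp only [one_mul] at this
    change (-1) ^ n * (H^[n] (w.1, w.2 + -η)).2 ≤ _
    linarith
  obtain ⟨a, ha, hga⟩ := intermediate_value_Icc (by linarith : -η ≤ η) hg.continuousOn ⟨hlo, hup⟩
  set u : ℝ × ℝ := (w.1, w.2 + a) with hu
  have huy : (H^[n] u).2 = e.2 := by
    have : (-1) ^ n * ((-1) ^ n * (H^[n] u).2) = (-1) ^ n * ((-1) ^ n * e.2) := by rw [← hga]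
    rwa [← mul_assoc, ← mul_assoc, hsq, one_mul, one_mul] at this
  -- The difference `u - w` is vertical, so its size does not decrease with time; it is bounded by
  -- its value at time `n`, where `u` has the height of `e`.
  have hdiff : ∀ k ≤ n, ‖H^[k] u - H^[k] w‖ ≤ 2 * δ := by
    intro k hk
    have key : ∀ s : ℝ, (s = 1 ∨ s = -1) → 0 ≤ s * a → ‖H^[k] u - H^[k] w‖ ≤ 2 * δ := by
      intro s hs hsa
      obtain ⟨h1, h2⟩ := h.iterate_vertical hs (z := u) (w := w) (by simpa [hu] using hsa) k
      obtain ⟨-, h4⟩ := h.iterate_vertical (sign_pow hs k) h1 (n - k)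
      rw [← Function.iterate_add_apply, ← Function.iterate_add_apply, Nat.sub_add_cancel hk, huy]
        at h4
      have h5 : s * (-1) ^ k * (-1) ^ (n - k) * (e.2 - (H^[n] w).2) ≤ 2 * δ := by
        have : s * (-1) ^ k * (-1) ^ (n - k) = s * (-1) ^ n := by
          rw [mul_assoc, ← pow_add, Nat.add_sub_cancel' hk]
        rw [this]
        rcases hs with rfl | rfl <;> linarith
      have h6 : 0 ≤ s * (-1) ^ k * ((H^[k] u).2 - (H^[k] w).2) := (abs_nonneg _).trans h1
      have h7 : s * (-1) ^ k * ((H^[k] u).2 - (H^[k] w).2) ≤ 2 * δ :=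
        le_trans (le_mul_of_one_le_left h6 (one_le_pow₀ hm1.le)) (h4.trans h5)
      rw [Prod.norm_def, Real.norm_eq_abs, Real.norm_eq_abs]
      refine max_le (h1.trans h7) ?_
      rcases sign_pow hs k with e | e <;> rw [e] at h6 h7 <;>
        simp only [Prod.snd_sub] <;> rw [abs_le] <;> constructor <;> linarith
    rcases le_total 0 a with h0 | h0
    · exact key 1 (Or.inl rfl) (by linarith)
    · exact key (-1) (Or.inr rfl) (by linarith)
  have hu3 : ∀ k ≤ n, ‖H^[k] u‖ ≤ 3 * δ := fun k hk => by
    have := norm_le_norm_add_norm_sub' (H^[k] u) (H^[k] w)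
    linarith [hdiff k hk, hw k hk]
  refine ⟨u, rfl, ?_, hu3, ?_⟩
  · simp only [hu, add_sub_cancel_left]; exact abs_le.2 ⟨ha.1, ha.2⟩
  -- At time `n` the heights agree, so the difference from `e` is horizontal and has been contracted
  -- since time `0`, when it was at most `3 * δ + δ`.
  · have h1 := h.iterate_horizontal (z := u) (w := e₀) n (by
      change |(H^[n] u).2 - e.2| ≤ _
      rw [huy]; simp)
    have h2 : |u.1 - e₀.1| ≤ 4 * δ := by
      refine (norm_fst_le (u - e₀)).trans ((norm_sub_le _ _).trans ?_)
      have := hu3 0 (Nat.zero_le _)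
      simp only [Function.iterate_zero, id_eq] at this
      linarith
    rw [Prod.norm_def]
    have h3 : (H^[n] u - e).2 = 0 := by simp [huy]
    rw [h3, norm_zero, max_eq_left (norm_nonneg _)]
    exact h1.trans (mul_le_mul_of_nonneg_left h2 (pow_nonneg h.l_nonneg n))

end FlipSaddle

/-! ### From a planar germ to a global map -/

/-- The radial retraction of the plane onto the square of half-side `δ`. -/
def clip (δ : ℝ) (z : ℝ × ℝ) : ℝ × ℝ := (max (-δ) (min δ z.1), max (-δ) (min δ z.2))

theorem clip_of_norm_le {δ : ℝ} {z : ℝ × ℝ} (hz : ‖z‖ ≤ δ) : clip δ z = z := by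
  have h1 := abs_le.1 ((norm_fst_le z).trans hz)
  have h2 := abs_le.1 ((norm_snd_le z).trans hz)
  simp [clip, min_eq_right h1.2, min_eq_right h2.2, max_eq_right h1.1, max_eq_right h2.1]

theorem norm_clip_le {δ : ℝ} (hδ : 0 ≤ δ) (z : ℝ × ℝ) : ‖clip δ z‖ ≤ δ := by
  rw [Prod.norm_def, Real.norm_eq_abs, Real.norm_eq_abs]
  refine max_le (abs_le.2 ⟨le_max_left _ _, max_le (by linarith) (min_le_left _ _)⟩)
    (abs_le.2 ⟨le_max_left _ _, max_le (by linarith) (min_le_left _ _)⟩)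

theorem norm_clip_sub_clip_le (δ : ℝ) (z w : ℝ × ℝ) : ‖clip δ z - clip δ w‖ ≤ ‖z - w‖ := by
  have key : ∀ a b : ℝ, |max (-δ) (min δ a) - max (-δ) (min δ b)| ≤ |a - b| := by
    intro a b
    refine (abs_max_sub_max_le_max (-δ) (min δ a) (-δ) (min δ b)).trans ?_
    refine max_le (by simp) ((abs_min_sub_min_le_max _ _ _ _).trans (max_le (by simp) le_rfl))
  rw [Prod.norm_def, Prod.norm_def]
  exact max_le_max (key _ _) (key _ _)

/-- A planar germ with derivative `diag(a, b)` at its fixed point, `|a| < 1`, `b < -1`, extends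
to a global map satisfying the cone conditions. -/
theorem exists_flipSaddle_extension {P : ℝ × ℝ → ℝ × ℝ} {B : ℝ × ℝ →L[ℝ] ℝ × ℝ}
    (hP : HasStrictFDerivAt P B 0) (hP0 : P 0 = 0) {a b : ℝ} (hB : ∀ z, B z = (a * z.1, b * z.2))
    (ha : |a| < 1) (hb : b < -1) :
    ∃ (H : ℝ × ℝ → ℝ × ℝ) (l m K δ : ℝ), FlipSaddle H l m K ∧ 0 < δ ∧ ∀ z, ‖z‖ ≤ δ → H z = P z := by
  obtain ⟨ε, hε, hε1, hε2⟩ : ∃ ε : ℝ, 0 < ε ∧ |a| + ε < 1 ∧ 1 < -b - ε := by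
    refine ⟨min (1 - |a|) (-b - 1) / 2, ?_, ?_, ?_⟩
    · have := lt_min (sub_pos.2 ha) (by linarith : (0 : ℝ) < -b - 1)
      linarith
    · have := min_le_left (1 - |a|) (-b - 1)
      linarith
    · have := min_le_right (1 - |a|) (-b - 1)
      linarith
  obtain ⟨U, hU, hUP⟩ := hP.approximates_deriv_on_nhds (c := ⟨ε, hε.le⟩) (Or.inr hε)
  obtain ⟨δ, hδ, hδU⟩ := Metric.nhds_basis_closedBall.mem_iff.1 hU
  -- The nonlinear part is `ε`-Lipschitz on the small square by strict differentiability. Composing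
  -- with the `1`-Lipschitz map `clip` keeps the constant, so `B + R` is a small Lipschitz
  -- perturbation of `B` on the whole plane.
  let R : ℝ × ℝ → ℝ × ℝ := fun z => P (clip δ z) - B (clip δ z)
  have hR : ∀ z w, ‖R z - R w‖ ≤ ε * ‖z - w‖ := by
    intro z w
    have := hUP _ (hδU (mem_closedBall_zero_iff.2 (norm_clip_le hδ.le z))) _
      (hδU (mem_closedBall_zero_iff.2 (norm_clip_le hδ.le w)))
    have e : R z - R w = P (clip δ z) - P (clip δ w) - B (clip δ z - clip δ w) := by
      simp only [R, map_sub]; abel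
    rw [e]
    exact this.trans (mul_le_mul_of_nonneg_left (norm_clip_sub_clip_le δ z w) hε.le)
  have hR1 : ∀ z w, |(R z).1 - (R w).1| ≤ ε * ‖z - w‖ :=
    fun z w => (norm_fst_le (R z - R w)).trans (hR z w)
  have hR2 : ∀ z w, |(R z).2 - (R w).2| ≤ ε * ‖z - w‖ :=
    fun z w => (norm_snd_le (R z - R w)).trans (hR z w)
  have hnorm : ∀ z w : ℝ × ℝ, ‖z - w‖ = max |z.1 - w.1| |z.2 - w.2| := fun z w => rfl
  refine ⟨fun z => B z + R z, |a| + ε, -b - ε, ‖B‖ + ε + 1, δ, ?_, hδ, ?_⟩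
  · refine ⟨by positivity, hε1, hε2, ?_, ?_, ?_, ?_, ?_⟩
    · have := norm_nonneg B
      linarith
    · have : clip δ 0 = 0 := clip_of_norm_le (by simpa using hδ.le)
      simp [R, this, hP0]
    · intro z w
      have e : B z + R z - (B w + R w) = B (z - w) + (R z - R w) := by rw [map_sub]; abel
      rw [e]
      refine (norm_add_le _ _).trans ?_
      have h1 := B.le_opNorm (z - w)
      have h2 := hR z w
      have h3 := norm_nonneg (z - w)
      linarith
    · intro z w
      have h1 := hR1 z w
      rw [hnorm] at h1
      simp only [hB, Prod.fst_add]
      have e : a * z.1 + (R z).1 - (a * w.1 + (R w).1) = a * (z.1 - w.1) + ((R z).1 - (R w).1) := by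
        ring
      rw [e]
      refine (abs_add_le _ _).trans ?_
      rw [abs_mul, add_mul]
      gcongr
      exact le_max_left _ _
    · intro z w hv
      have h0 : 0 ≤ z.2 - w.2 := (abs_nonneg _).trans hv
      have h1 := hR2 z w
      rw [hnorm, abs_of_nonneg h0, max_eq_right hv, abs_le] at h1
      simp only [hB, Prod.snd_add]
      linarith [h1.2]
  · intro z hz
    simp [R, clip_of_norm_le hz]

/-- The map `z ↦ r z / (1 + ‖z‖)` carries the punctured plane, which is connected, onto the
punctured ball. -/
theorem isPreconnected_ball_diff_zero {r : ℝ} (hr : 0 < r) :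
    IsPreconnected (Metric.ball (0 : ℝ × ℝ) r \ {0}) := by
  have h1 : IsPreconnected ({0}ᶜ : Set (ℝ × ℝ)) :=
    (isConnected_compl_singleton_of_one_lt_rank (by
      rw [← Module.finrank_eq_rank]; simp) 0).isPreconnected
  let g : ℝ × ℝ → ℝ × ℝ := fun z => (r / (1 + ‖z‖)) • z
  have hg : Continuous g := by
    exact (continuous_const.div (continuous_const.add continuous_norm) fun z : ℝ × ℝ =>
      (by positivity : 1 + ‖z‖ ≠ 0)).smul continuous_id
  convert h1.image g hg.continuousOn using 1
  ext w
  simp only [Set.mem_sdiff, mem_ball_zero_iff, mem_singleton_iff, mem_image, mem_compl_iff]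
  constructor
  · rintro ⟨hw, hw0⟩
    have hpos : 0 < r - ‖w‖ := by linarith
    refine ⟨(r - ‖w‖)⁻¹ • w, by simp [hw0, hpos.ne'], ?_⟩
    simp only [g, norm_smul, norm_inv, Real.norm_eq_abs, abs_of_pos hpos, smul_smul]
    have : r / (1 + (r - ‖w‖)⁻¹ * ‖w‖) * (r - ‖w‖)⁻¹ = 1 := by
      have h2 : (1 + (r - ‖w‖)⁻¹ * ‖w‖) = r * (r - ‖w‖)⁻¹ := by field_simp; ring
      rw [h2]; field_simp
    rw [this, one_smul]
  · rintro ⟨z, hz, rfl⟩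
    have h2 : 0 < 1 + ‖z‖ := by positivity
    refine ⟨?_, by simp [g, hz, hr.ne', h2.ne']⟩
    simp only [g, norm_smul, norm_div, Real.norm_eq_abs, abs_of_pos hr, abs_of_pos h2]
    rw [div_mul_eq_mul_div, div_lt_iff₀ h2]
    nlinarith

/-! ### Periodic orbits and their stable manifolds -/

section Orbits

variable {M : Type*} [TopologicalSpace M] {f : Flow ℝ M} {O O' : Set M} {p : M} {T : ℝ}

theorem IsPeriodicOrbitAt.pos (h : IsPeriodicOrbitAt f O p T) : 0 < T := h.1.1.1

theorem IsPeriodicOrbitAt.map_period (h : IsPeriodicOrbitAt f O p T) : f T p = p := h.1.1.2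

theorem IsPeriodicOrbitAt.flow_mem (h : IsPeriodicOrbitAt f O p T) (t : ℝ) : f t p ∈ O := by
  rw [h.2]; exact mem_range_self t

theorem IsPeriodicOrbitAt.base_mem (h : IsPeriodicOrbitAt f O p T) : p ∈ O := by
  simpa using h.flow_mem 0

theorem Flow.neg_map_map (f : Flow ℝ M) (t : ℝ) (x : M) : f (-t) (f t x) = x := by
  rw [← f.map_add, neg_add_cancel, f.map_zero_apply]

theorem Flow.map_neg_map (f : Flow ℝ M) (t : ℝ) (x : M) : f t (f (-t) x) = x := by
  rw [← f.map_add, add_neg_cancel, f.map_zero_apply]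

theorem Flow.image_mem_nhds (f : Flow ℝ M) (t : ℝ) {x : M} {V : Set M} (hV : V ∈ 𝓝 x) :
    {y | f (-t) y ∈ V} ∈ 𝓝 (f t x) := by
  have : Tendsto (f (-t)) (𝓝 (f t x)) (𝓝 (f (-t) (f t x))) :=
    (f.continuous_toFun (-t)).continuousAt
  rw [f.neg_map_map] at this
  exact this hV

theorem Flow.preimage_mem_nhds (f : Flow ℝ M) (t : ℝ) {x : M} {V : Set M} (hV : V ∈ 𝓝 (f t x)) :
    {y | f t y ∈ V} ∈ 𝓝 x :=
  (f.continuous_toFun t).continuousAt hV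

theorem flow_nat_mul_period (h : f T p = p) (n : ℕ) : f (n * T) p = p := by
  induction n with
  | zero => simp
  | succ n ih => push_cast; rw [add_mul, one_mul, f.map_add, h, ih]

theorem flow_int_mul_period (h : f T p = p) (n : ℤ) : f (n * T) p = p := by
  obtain ⟨k, rfl | rfl⟩ := n.eq_nat_or_neg
  · exact_mod_cast flow_nat_mul_period h k
  · have := congrArg (f (-(k * T))) (flow_nat_mul_period h k)
    rw [f.neg_map_map] at this
    push_cast
    rw [neg_mul]; exact this.symm

theorem IsPeriodicOrbitAt.exists_mem_Ico (h : IsPeriodicOrbitAt f O p T) {x : M} (hx : x ∈ O)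
    (a : ℝ) : ∃ t ∈ Ico a (a + T), f t p = x := by
  rw [h.2] at hx
  obtain ⟨s, rfl⟩ := hx
  obtain ⟨n, hn, -⟩ := existsUnique_add_zsmul_mem_Ico h.pos s a
  refine ⟨_, hn, ?_⟩
  simp only [zsmul_eq_mul]
  rw [f.map_add, flow_int_mul_period h.map_period]

theorem IsPeriodicOrbitAt.isCompact (h : IsPeriodicOrbitAt f O p T) : IsCompact O := by
  have : O = (fun t => f t p) '' Icc 0 (0 + T) := by
    refine Subset.antisymm (fun x hx => ?_) ?_
    · obtain ⟨t, ht, rfl⟩ := h.exists_mem_Ico hx 0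
      exact ⟨t, Ico_subset_Icc_self ht, rfl⟩
    · rintro _ ⟨t, -, rfl⟩
      exact h.flow_mem t
  rw [this]
  exact isCompact_Icc.image (by fun_prop)

theorem IsPeriodicOrbit.isCompact (h : IsPeriodicOrbit f O) : IsCompact O := by
  obtain ⟨p, T, h⟩ := h
  exact h.isCompact

theorem IsPeriodicOrbit.flow_mem (h : IsPeriodicOrbit f O) {x : M} (hx : x ∈ O) (t : ℝ) :
    f t x ∈ O := by
  obtain ⟨p, T, h⟩ := h
  rw [h.2] at hx ⊢
  obtain ⟨s, rfl⟩ := hx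
  exact ⟨t + s, f.map_add _ _ _⟩

theorem IsPeriodicOrbit.eq_range (h : IsPeriodicOrbit f O) {x : M} (hx : x ∈ O) :
    O = range fun t => f t x := by
  refine Subset.antisymm (fun y hy => ?_) (range_subset_iff.2 (h.flow_mem hx))
  obtain ⟨p, T, h⟩ := h
  rw [h.2] at hx hy
  obtain ⟨s, rfl⟩ := hx
  obtain ⟨t, rfl⟩ := hy
  refine ⟨t - s, ?_⟩
  simp only [← f.map_add, sub_add_cancel]

theorem IsPeriodicOrbit.eq_of_mem (h : IsPeriodicOrbit f O) (h' : IsPeriodicOrbit f O') {x : M}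
    (hx : x ∈ O) (hx' : x ∈ O') : O = O' := by
  rw [h.eq_range hx, h'.eq_range hx']

theorem IsPeriodicOrbit.subset_nonwanderingSet (h : IsPeriodicOrbit f O) :
    O ⊆ nonwanderingSet f := by
  obtain ⟨p, T, h⟩ := h
  intro x hx U hU t₀
  obtain ⟨s, -, rfl⟩ := h.exists_mem_Ico hx 0
  obtain ⟨n, hn⟩ := exists_nat_ge (t₀ / T)
  refine ⟨n * T, (div_le_iff₀ h.pos).1 hn, f s p, ⟨f s p, mem_of_mem_nhds hU, ?_⟩,
    mem_of_mem_nhds hU⟩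
  rw [← f.map_add, add_comm, f.map_add, flow_nat_mul_period h.map_period]

theorem flow_mem_stableManifold (t : ℝ) {x : M} :
    f t x ∈ stableManifold f O ↔ x ∈ stableManifold f O := by
  have key : ∀ (t : ℝ) (x : M), x ∈ stableManifold f O → f t x ∈ stableManifold f O := by
    intro t x hx
    have := Tendsto.comp (show Tendsto _ _ _ from hx) (tendsto_atTop_add_const_right _ t tendsto_id)
    refine this.congr fun s => ?_
    simp [f.map_add]
  exact ⟨fun h => by simpa [f.neg_map_map] using key (-t) _ h, key t x⟩

theorem IsPeriodicOrbit.subset_stableManifold (h : IsPeriodicOrbit f O) :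
    O ⊆ stableManifold f O :=
  fun _ hx => (tendsto_principal.2 (Eventually.of_forall fun t => h.flow_mem hx t)).mono_right
    principal_le_nhdsSet

/-- Trajectories which converge to a periodic orbit keep visiting the neighbourhoods of each of
its points. -/
theorem IsPeriodicOrbitAt.exists_flow_mem (h : IsPeriodicOrbitAt f O p T) {x : M}
    (hx : x ∈ stableManifold f O) {V : Set M} (hV : V ∈ 𝓝 p) (t₀ : ℝ) : ∃ t, t₀ ≤ t ∧ f t x ∈ V := by
  have hW : {y | ∃ s ∈ Ico 0 (0 + T), f (-s) y ∈ V} ∈ 𝓝ˢ O := by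
    rw [mem_nhdsSet_iff_forall]
    intro y hy
    obtain ⟨s, hs, rfl⟩ := h.exists_mem_Ico hy 0
    filter_upwards [f.image_mem_nhds s hV] with z hz
    exact ⟨s, hs, hz⟩
  obtain ⟨t, ht, s, hs, hts⟩ :=
    ((eventually_ge_atTop (t₀ + T)).and ((show Tendsto _ _ _ from hx).eventually hW)).exists
  refine ⟨-s + t, ?_, by rwa [f.map_add]⟩
  have := hs.2
  linarith

/-- An invariant set which is a neighbourhood of one point of a periodic orbit is a neighbourhood
of its whole stable manifold. -/
theorem IsPeriodicOrbitAt.mem_nhds_of_invariant (h : IsPeriodicOrbitAt f O p T) {E : Set M}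
    (hE : ∀ t x, x ∈ E → f t x ∈ E) (hp : E ∈ 𝓝 p) {x : M} (hx : x ∈ stableManifold f O) :
    E ∈ 𝓝 x := by
  obtain ⟨t, -, ht⟩ := h.exists_flow_mem hx (interior_mem_nhds.2 hp) 0
  filter_upwards [f.preimage_mem_nhds t (mem_interior_iff_mem_nhds.1 ht)] with y hy
  simpa [f.neg_map_map] using hE (-t) _ hy

theorem IsPeriodicOrbitAt.isOpen_stableManifold (h : IsPeriodicOrbitAt f O p T)
    (hp : stableManifold f O ∈ 𝓝 p) : IsOpen (stableManifold f O) :=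
  isOpen_iff_mem_nhds.2 fun _ hx =>
    h.mem_nhds_of_invariant (fun t _ => (flow_mem_stableManifold t).2) hp hx

end Orbits

/-! ### Flows whose nonwandering set is a finite union of periodic orbits -/

section Decomposition

variable {M : Type*} [TopologicalSpace M]

/-- The nonwandering set is the union of the finite family `P` of periodic orbits. -/
structure IsOrbitDecomposition (f : Flow ℝ M) (P : Set (Set M)) : Prop where
  finite : P.Finite
  periodic : ∀ O ∈ P, IsPeriodicOrbit f O
  eq_sUnion : nonwanderingSet f = ⋃₀ P

variable {f : Flow ℝ M} {P : Set (Set M)}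

theorem IsOrbitDecomposition.mem_of_isPeriodicOrbit (h : IsOrbitDecomposition f P) {O : Set M}
    (hO : IsPeriodicOrbit f O) : O ∈ P := by
  obtain ⟨p, T, hp⟩ := id hO
  have := hO.subset_nonwanderingSet hp.base_mem
  rw [h.eq_sUnion] at this
  obtain ⟨O', hO', hpO'⟩ := this
  rwa [hO.eq_of_mem (h.periodic O' hO') hp.base_mem hpO']

/-- The trajectory visits `U` at arbitrarily late times; two visits more than `t₀` apart show that
`U` returns to itself. -/
theorem mem_nonwanderingSet_of_mapClusterPt {x q : M}
    (h : MapClusterPt q atTop fun t : ℝ => f t x) : q ∈ nonwanderingSet f := by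
  intro U hU t₀
  have hfr := mapClusterPt_iff_frequently.1 h U hU
  obtain ⟨t₁, h₁⟩ := hfr.exists
  obtain ⟨t₂, h₂, h₃⟩ := (hfr.and_eventually (eventually_ge_atTop (t₁ + t₀))).exists
  refine ⟨t₂ - t₁, by linarith, f t₂ x, ⟨f t₁ x, h₁, ?_⟩, h₂⟩
  rw [← f.map_add, sub_add_cancel]

theorem nonwanderingSet_reverse (f : Flow ℝ M) :
    nonwanderingSet f.reverse = nonwanderingSet f := by
  have key : ∀ (g : Flow ℝ M) (t : ℝ) (U : Set M), (g (-t) '' U ∩ U).Nonempty →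
      (g t '' U ∩ U).Nonempty := by
    rintro g t U ⟨_, ⟨x, hx, rfl⟩, hx'⟩
    exact ⟨x, ⟨g (-t) x, hx', g.map_neg_map t x⟩, hx⟩
  ext x
  refine forall₃_congr fun U _ t₀ => exists_congr fun t => and_congr_right fun _ => ⟨?_, ?_⟩
  · exact key f t U
  · intro hU
    refine key f.reverse t U ?_
    have e : f.reverse (-t) = f t := by ext x; rw [Flow.reverse_apply, neg_neg]
    rwa [e]

theorem IsPeriodicOrbitAt.reverse {O : Set M} {p : M} {T : ℝ} (h : IsPeriodicOrbitAt f O p T) :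
    IsPeriodicOrbitAt f.reverse O p T := by
  have key : ∀ t : ℝ, f (-t) p = p ↔ f t p = p := fun t =>
    ⟨fun e => by have := congrArg (f t) e; rw [f.map_neg_map] at this; exact this.symm,
      fun e => by have := congrArg (f (-t)) e; rw [f.neg_map_map] at this; exact this.symm⟩
  refine ⟨?_, ?_⟩
  · simpa [Flow.reverse_apply, key] using h.1
  · rw [h.2]
    ext y
    simp only [mem_range, Flow.reverse_apply]
    exact ⟨fun ⟨t, ht⟩ => ⟨-t, by rwa [neg_neg]⟩, fun ⟨t, ht⟩ => ⟨-t, ht⟩⟩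

theorem IsOrbitDecomposition.reverse (h : IsOrbitDecomposition f P) :
    IsOrbitDecomposition f.reverse P where
  finite := h.finite
  periodic O hO := by
    obtain ⟨p, T, hp⟩ := h.periodic O hO
    exact ⟨p, T, hp.reverse⟩
  eq_sUnion := by rw [nonwanderingSet_reverse, h.eq_sUnion]

theorem IsOrbitDecomposition.disjoint_sUnion_diff (h : IsOrbitDecomposition f P) {O : Set M}
    (hO : O ∈ P) : Disjoint O (⋃₀ (P \ {O})) := by
  rw [Set.disjoint_left]
  rintro x hx ⟨O', ⟨hO', hne⟩, hx'⟩
  exact hne ((h.periodic O' hO').eq_of_mem (h.periodic O hO) hx' hx)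

variable [T2Space M]

theorem IsOrbitDecomposition.disjoint_nhdsSet (h : IsOrbitDecomposition f P) {O O' : Set M}
    (hO : O ∈ P) (hO' : O' ∈ P) (hne : O ≠ O') : Disjoint (𝓝ˢ O) (𝓝ˢ O') := by
  refine (SeparatedNhds.of_isCompact_isCompact (h.periodic O hO).isCompact
    (h.periodic O' hO').isCompact ?_).disjoint_nhdsSet
  rw [Set.disjoint_left]
  exact fun x hx hx' => hne ((h.periodic O hO).eq_of_mem (h.periodic O' hO') hx hx')

theorem IsOrbitDecomposition.eq_of_mem_stableManifold (h : IsOrbitDecomposition f P)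
    {O O' : Set M} (hO : O ∈ P) (hO' : O' ∈ P) {x : M} (hx : x ∈ stableManifold f O)
    (hx' : x ∈ stableManifold f O') : O = O' := by
  by_contra hne
  exact (show Tendsto _ _ _ from hx).not_tendsto (h.disjoint_nhdsSet hO hO' hne) hx'

theorem IsOrbitDecomposition.isClosed_sUnion_diff (h : IsOrbitDecomposition f P) (O : Set M) :
    IsClosed (⋃₀ (P \ {O})) :=
  by
  rw [sUnion_eq_biUnion]
  exact (h.finite.subset sdiff_subset).isClosed_biUnion fun _ hO' =>
    (h.periodic _ hO'.1).isCompact.isClosed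

variable [CompactSpace M]

/-- Every trajectory converges to one of the periodic orbits. -/
theorem IsOrbitDecomposition.exists_mem_stableManifold (h : IsOrbitDecomposition f P) (x : M) :
    ∃ O ∈ P, x ∈ stableManifold f O := by
  obtain ⟨q, hq⟩ : ∃ q, MapClusterPt q atTop fun t : ℝ => f t x :=
    exists_clusterPt_of_compactSpace _
  have hqΩ := mem_nonwanderingSet_of_mapClusterPt hq
  rw [h.eq_sUnion] at hqΩ
  obtain ⟨O, hO, hqO⟩ := hqΩ
  refine ⟨O, hO, ?_⟩
  obtain ⟨U, U', hU, hU', hOU, hOU', hd⟩ := SeparatedNhds.of_isCompact_isCompact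
    (h.periodic O hO).isCompact (h.isClosed_sUnion_diff O).isCompact (h.disjoint_sUnion_diff hO)
  change Tendsto _ _ _
  rw [(hasBasis_nhdsSet O).tendsto_right_iff]
  rintro W ⟨hW, hOW⟩
  -- Otherwise, by compactness, the trajectory has a cluster point outside these neighbourhoods of
  -- all the periodic orbits, although cluster points are nonwandering.
  have hN : ∀ᶠ t in atTop, f t x ∈ (U ∩ W) ∪ U' := by
    by_contra hcon
    obtain ⟨a, ha, hcl⟩ := (((hU.inter hW).union hU').isClosed_compl.isCompact
      (X := M)).exists_mapClusterPt_of_frequently (f := fun t : ℝ => f t x)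
      (not_eventually.1 hcon)
    have haΩ := mem_nonwanderingSet_of_mapClusterPt hcl
    rw [h.eq_sUnion] at haΩ
    obtain ⟨O', hO', haO'⟩ := haΩ
    by_cases hne : O' = O
    · subst hne
      exact ha (Or.inl ⟨hOU haO', hOW haO'⟩)
    · exact ha (Or.inr (hOU' ⟨O', ⟨hO', hne⟩, haO'⟩))
  obtain ⟨t₁, ht₁⟩ := eventually_atTop.1 hN
  have hfr := mapClusterPt_iff_frequently.1 hq _ ((hU.inter hW).mem_nhds ⟨hOU hqO, hOW hqO⟩)
  obtain ⟨t₂, h₂, h₃⟩ := (hfr.and_eventually (eventually_ge_atTop t₁)).exists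
  -- The tail of the trajectory is connected and covered by two disjoint open sets, so it stays in
  -- the one that it visits, that of `O`.
  have hsub : (fun t => f t x) '' Ici t₁ ⊆ U ∩ W := by
    refine IsPreconnected.subset_left_of_subset_union (hU.inter hW) hU'
      (hd.mono_left inter_subset_left) ?_ ⟨f t₂ x, ⟨t₂, h₃, rfl⟩, h₂⟩
      (isPreconnected_Ici.image _ (by fun_prop))
    rintro _ ⟨t, ht, rfl⟩
    exact ht₁ t ht
  filter_upwards [eventually_ge_atTop t₁] with t ht
  exact (hsub ⟨t, ht, rfl⟩).2

/-- The trajectory converges to some orbit of `P`, and distinct orbits have disjoint neighbourhoods,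
so recurrent visits near one point of `O` identify the limit. -/
theorem IsOrbitDecomposition.mem_stableManifold_of_frequently (h : IsOrbitDecomposition f P)
    {O : Set M} (hO : O ∈ P) {x q : M} (hq : q ∈ O)
    (hx : ∀ V ∈ 𝓝 q, ∃ᶠ t in atTop, f t x ∈ V) : x ∈ stableManifold f O := by
  obtain ⟨O', hO', hx'⟩ := h.exists_mem_stableManifold x
  by_cases hne : O = O'
  · rwa [hne]
  · exfalso
    obtain ⟨U, hU, U', hU', hd⟩ := Filter.disjoint_iff.1 (h.disjoint_nhdsSet hO hO' hne)
    obtain ⟨t, ht, ht'⟩ := ((hx U (nhds_le_nhdsSet hq hU)).and_eventually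
      ((show Tendsto _ _ _ from hx').eventually hU')).exists
    exact Set.disjoint_left.1 hd ht ht'

end Decomposition

/-! ### Local cross-sections and asymptotic stability -/

section Sections

variable {M : Type*} [TopologicalSpace M]

/-- `σ` parametrises a local section of the flow at `p`, with first return map (or an iterate of
it) `G` and return time `τ` close to `θ`. -/
structure IsFlowSection (f : Flow ℝ M) (p : M) (θ : ℝ) (σ : ℝ × ℝ → M) (G : ℝ × ℝ → ℝ × ℝ)
    (τ : ℝ × ℝ → ℝ) (r : ℝ) : Prop where
  r_pos : 0 < r
  θ_pos : 0 < θ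
  zero : σ 0 = p
  cont : ContinuousOn σ (Metric.ball 0 r)
  map_zero : G 0 = 0
  return_eq : ∀ y, ‖y‖ < r → f (τ y) (σ y) = σ (G y)
  le_time : ∀ y, ‖y‖ < r → θ / 2 ≤ τ y
  time_le : ∀ y, ‖y‖ < r → τ y ≤ 2 * θ
  box : ∀ ε > 0, ∀ ρ > 0, {x | ∃ t y, |t| < ε ∧ ‖y‖ < ρ ∧ f t (σ y) = x} ∈ 𝓝 p
  inj : ∃ ε > 0, ∀ t y, |t| < ε → ‖y‖ < r → f t p = σ y → y = 0

namespace IsFlowSection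

variable {f : Flow ℝ M} {p : M} {θ : ℝ} {σ : ℝ × ℝ → M} {G : ℝ × ℝ → ℝ × ℝ} {τ : ℝ × ℝ → ℝ} {r : ℝ}

theorem congr_of_le (h : IsFlowSection f p θ σ G τ r) {G' : ℝ × ℝ → ℝ × ℝ} {ρ : ℝ} (hρ : 0 < ρ)
    (hρr : ρ ≤ r) (hG : ∀ y, ‖y‖ < ρ → G' y = G y) : IsFlowSection f p θ σ G' τ ρ where
  r_pos := hρ
  θ_pos := h.θ_pos
  zero := h.zero
  cont := h.cont.mono (Metric.ball_subset_ball hρr)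
  map_zero := by rw [hG 0 (by simpa using hρ), h.map_zero]
  return_eq y hy := by rw [hG y hy, h.return_eq y (hy.trans_le hρr)]
  le_time y hy := h.le_time y (hy.trans_le hρr)
  time_le y hy := h.time_le y (hy.trans_le hρr)
  box := h.box
  inj := by
    obtain ⟨ε, hε, hinj⟩ := h.inj
    exact ⟨ε, hε, fun t y ht hy => hinj t y ht (hy.trans_le hρr)⟩

theorem continuousAt (h : IsFlowSection f p θ σ G τ r) {y : ℝ × ℝ} (hy : ‖y‖ < r) :
    ContinuousAt σ y :=
  h.cont.continuousAt (Metric.isOpen_ball.mem_nhds (mem_ball_zero_iff.2 hy))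

theorem exists_iterate_time (h : IsFlowSection f p θ σ G τ r) (n : ℕ) {y : ℝ × ℝ}
    (hy : ∀ k < n, ‖G^[k] y‖ < r) : ∃ t, n * (θ / 2) ≤ t ∧ f t (σ y) = σ (G^[n] y) := by
  induction n with
  | zero => exact ⟨0, by simp, by simp⟩
  | succ n ih =>
    obtain ⟨t, ht, he⟩ := ih fun k hk => hy k (hk.trans n.lt_succ_self)
    have hn := hy n n.lt_succ_self
    refine ⟨τ (G^[n] y) + t, ?_, ?_⟩
    · have := h.le_time _ hn
      push_cast
      linarith
    · rw [f.map_add, he, h.return_eq _ hn, Function.iterate_succ_apply']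

/-- A trajectory which keeps returning to the section is, at any positive time, at a bounded time
after one of its returns. -/
theorem exists_flow_eq_of_mapsTo (h : IsFlowSection f p θ σ G τ r) {I : Set (ℝ × ℝ)}
    (hI : ∀ y ∈ I, ‖y‖ < r) (hGI : MapsTo G I I) {y : ℝ × ℝ} (hy : y ∈ I) {t : ℝ} (ht : 0 ≤ t) :
    ∃ y' ∈ I, ∃ s ∈ Icc 0 (2 * θ), f t (σ y) = f s (σ y') := by
  have key : ∀ n : ℕ, ∀ y ∈ I, ∀ t, 0 ≤ t → t ≤ n * (θ / 2) →
      ∃ y' ∈ I, ∃ s ∈ Icc 0 (2 * θ), f t (σ y) = f s (σ y') := by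
    have hθ := h.θ_pos
    intro n
    induction n with
    | zero =>
      intro y hy t ht ht'
      simp only [Nat.cast_zero, zero_mul] at ht'
      exact ⟨y, hy, t, ⟨ht, by linarith⟩, rfl⟩
    | succ n ih =>
      intro y hy t ht ht'
      rcases le_total t (τ y) with hc | hc
      · exact ⟨y, hy, t, ⟨ht, hc.trans (h.time_le y (hI y hy))⟩, rfl⟩
      · have h1 := h.le_time y (hI y hy)
        push_cast at ht'
        obtain ⟨y', hy', s, hs, he⟩ := ih (G y) (hGI hy) (t - τ y) (by linarith) (by linarith)
        refine ⟨y', hy', s, hs, ?_⟩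
        rw [← he, ← h.return_eq y (hI y hy), ← f.map_add, sub_add_cancel]
  obtain ⟨n, hn⟩ := exists_nat_ge (t / (θ / 2))
  exact key n y hy t ht ((div_le_iff₀ (half_pos h.θ_pos)).1 hn)

variable {P : Set (Set M)} {O : Set M} {T : ℝ}

/-- Close to `p`, the section meets the nonwandering set in `p` only. -/
theorem exists_isolating [T2Space M] (h : IsFlowSection f p θ σ G τ r)
    (hd : IsOrbitDecomposition f P) (hO : IsPeriodicOrbitAt f O p T) :
    ∃ ρ, 0 < ρ ∧ ρ ≤ r ∧ ∀ y, ‖y‖ < ρ → σ y ∈ nonwanderingSet f → y = 0 := by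
  have hOP : O ∈ P := hd.mem_of_isPeriodicOrbit ⟨p, T, hO⟩
  obtain ⟨ε, hε, hinj⟩ := h.inj
  -- `C` is the closed arc of `O` away from `p`. Near `p` the section avoids `C` and the other
  -- orbits; the remaining short arc of `O` through `p` is handled by `inj`.
  set C : Set M := (fun t => f t p) '' Icc (ε / 2) (T - ε / 2)
  have hC : IsClosed C := (isCompact_Icc.image (by fun_prop)).isClosed
  have hpC : p ∉ C := by
    rintro ⟨t, ht, hpt⟩
    have := hO.1.2 ⟨by linarith [ht.1], hpt⟩
    linarith [ht.2]
  have hp' : p ∉ ⋃₀ (P \ {O}) := Set.disjoint_left.1 (hd.disjoint_sUnion_diff hOP) hO.base_mem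
  have hev : ∀ᶠ y in 𝓝 (0 : ℝ × ℝ), σ y ∈ (C ∪ ⋃₀ (P \ {O}))ᶜ := by
    refine (h.continuousAt (by simpa using h.r_pos)).eventually_mem ?_
    rw [h.zero]
    exact (hC.union (hd.isClosed_sUnion_diff O)).isOpen_compl.mem_nhds (by simp [hpC, hp'])
  obtain ⟨ρ, hρ, hρσ⟩ := Metric.eventually_nhds_iff.1 hev
  refine ⟨min ρ r, lt_min hρ h.r_pos, min_le_right _ _, fun y hy hyΩ => ?_⟩
  have hyσ := hρσ (y := y) (by simpa using hy.trans_le (min_le_left _ _))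
  rw [mem_compl_iff, mem_union, not_or] at hyσ
  rw [hd.eq_sUnion] at hyΩ
  obtain ⟨O', hO', hyO'⟩ := hyΩ
  have hOO' : O' = O := by
    by_contra hne
    exact hyσ.2 ⟨O', ⟨hO', hne⟩, hyO'⟩
  subst hOO'
  obtain ⟨t, ht, hty⟩ := hO.exists_mem_Ico hyO' (-(ε / 2))
  refine hinj t y ?_ (hy.trans_le (min_le_right _ _)) hty
  rw [abs_lt]
  refine ⟨by linarith [ht.1], ?_⟩
  by_contra hcon
  exact hyσ.1 ⟨t, ⟨by linarith, by linarith [ht.2]⟩, hty⟩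

theorem mem_stableManifold_of_tendsto [T2Space M] [CompactSpace M]
    (h : IsFlowSection f p θ σ G τ r) (hd : IsOrbitDecomposition f P)
    (hO : IsPeriodicOrbitAt f O p T) {y : ℝ × ℝ} (hy : ∀ k, ‖G^[k] y‖ < r)
    (hlim : Tendsto (fun k => G^[k] y) atTop (𝓝 0)) : σ y ∈ stableManifold f O := by
  refine hd.mem_stableManifold_of_frequently (hd.mem_of_isPeriodicOrbit ⟨p, T, hO⟩) hO.base_mem
    fun V hV => frequently_atTop.2 fun t₀ => ?_
  have h1 : ∀ᶠ k in atTop, σ (G^[k] y) ∈ V := by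
    refine ((h.continuousAt (by simpa using h.r_pos)).tendsto.comp hlim).eventually_mem ?_
    rwa [h.zero]
  obtain ⟨n, hn, hn'⟩ := (h1.and (eventually_ge_atTop ⌈t₀ / (θ / 2)⌉₊)).exists
  obtain ⟨t, ht, he⟩ := h.exists_iterate_time n fun k _ => hy k
  refine ⟨t, le_trans ?_ ht, he ▸ hn⟩
  have := (Nat.le_ceil _).trans (Nat.cast_le (α := ℝ).2 hn')
  exact (div_le_iff₀ (half_pos h.θ_pos)).1 this

/-- A contracting return map makes the periodic orbit asymptotically stable. -/
theorem asymptoticallyStable [T2Space M] [CompactSpace M]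
    (h : IsFlowSection f p θ σ G τ r) (hd : IsOrbitDecomposition f P)
    (hO : IsPeriodicOrbitAt f O p T) (hG : ∀ y, ‖y‖ < r → ‖G y‖ ≤ ‖y‖ / 2) :
    stableManifold f O ∈ 𝓝 p ∧ ∀ U ∈ 𝓝ˢ O, ∃ V ∈ 𝓝 p, ∀ x ∈ V, ∀ t, 0 ≤ t → f t x ∈ U := by
  have hθ := h.θ_pos
  constructor
  · filter_upwards [h.box 1 one_pos r h.r_pos] with x ⟨t, y, _, hy, hx⟩
    rw [← hx, flow_mem_stableManifold]
    have hk : ∀ k, ‖G^[k] y‖ ≤ (1 / 2) ^ k * ‖y‖ ∧ ‖G^[k] y‖ < r := by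
      intro k
      induction k with
      | zero => simpa using hy
      | succ k ih =>
        rw [Function.iterate_succ_apply']
        have h1 := hG _ ih.2
        have h0 := norm_nonneg (G^[k] y)
        refine ⟨?_, by linarith [ih.2]⟩
        rw [pow_succ]
        linarith [ih.1]
    refine h.mem_stableManifold_of_tendsto hd hO (fun k => (hk k).2) ?_
    refine squeeze_zero_norm (fun k => (hk k).1) ?_
    simpa using (tendsto_pow_atTop_nhds_zero_of_lt_one (by norm_num : (0 : ℝ) ≤ 1 / 2)
      (by norm_num)).mul_const ‖y‖
  · intro U hU
    -- The lower bound `-1` covers the flow-box time before the section is reached; the upper bound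
    -- `2 * θ` covers the time between consecutive returns.
    have hev : ∀ᶠ y in 𝓝 (0 : ℝ × ℝ), ∀ s ∈ Icc (-1) (2 * θ), f s (σ y) ∈ U := by
      refine isCompact_Icc.eventually_forall_of_forall_eventually fun s _ => ?_
      have hc : ContinuousAt (fun z : (ℝ × ℝ) × ℝ => f z.2 (σ z.1)) (0, s) := by
        have h1 : ContinuousAt (fun z : (ℝ × ℝ) × ℝ => σ z.1) (0, s) :=
          ContinuousAt.comp (g := σ) (h.continuousAt (by simpa using h.r_pos)) continuousAt_fst
        exact f.cont'.continuousAt.comp (continuousAt_snd.prodMk h1)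
      refine hc.eventually_mem ?_
      simp only [h.zero]
      exact nhds_le_nhdsSet (hO.flow_mem s) hU
    obtain ⟨ρ, hρ, hρU⟩ := Metric.eventually_nhds_iff.1 hev
    have hρ' := lt_min hρ h.r_pos
    refine ⟨_, h.box 1 one_pos _ hρ', ?_⟩
    rintro _ ⟨t₀, y, ht₀, hy, rfl⟩ t ht
    rw [← f.map_add]
    have hIU : ∀ z ∈ Metric.ball (0 : ℝ × ℝ) (min ρ r), ∀ s ∈ Icc (-1) (2 * θ), f s (σ z) ∈ U :=
      fun z hz => hρU (lt_of_lt_of_le (Metric.mem_ball.1 hz) (min_le_left _ _))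
    rcases le_total 0 (t + t₀) with hc | hc
    · obtain ⟨y', hy', s, hs, he⟩ := h.exists_flow_eq_of_mapsTo
        (I := Metric.ball 0 (min ρ r)) (y := y)
        (fun z hz => (mem_ball_zero_iff.1 hz).trans_le (min_le_right _ _))
        (fun z hz => by
          rw [mem_ball_zero_iff] at hz ⊢
          have := hG z (hz.trans_le (min_le_right _ _))
          have := norm_nonneg z
          linarith) (mem_ball_zero_iff.2 hy) hc
      rw [he]
      exact hIU y' hy' s ⟨by linarith [hs.1], hs.2⟩
    · exact hIU y (mem_ball_zero_iff.2 hy) _ ⟨by linarith [(abs_lt.1 ht₀).1], by linarith⟩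

end IsFlowSection

end Sections

/-! ### The neighbourhood of a flip saddle -/

section Saddle

variable {M : Type*} [TopologicalSpace M] [T2Space M] {f : Flow ℝ M} {P : Set (Set M)}
  {S : Set M} {p : M} {T θ : ℝ} {σ : ℝ × ℝ → M} {H : ℝ × ℝ → ℝ × ℝ} {τ : ℝ × ℝ → ℝ} {r l m K : ℝ}

namespace IsFlowSection

/-- Trajectories converging to a saddle orbit eventually stay close to it on the section. -/
theorem exists_local_of_mem_stableManifold (h : IsFlowSection f p θ σ H τ r)
    (hH : FlipSaddle H l m K) (hS : IsPeriodicOrbitAt f S p T)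
    (hiso : ∀ y, ‖y‖ < r → σ y ∈ nonwanderingSet f → y = 0) {x : M} (hx : x ∈ stableManifold f S)
    {ρ : ℝ} (hρ : 0 < ρ) (hρr : ρ < r) :
    ∃ t, 0 ≤ t ∧ ∃ w, f t x = σ w ∧ ∀ k, ‖H^[k] w‖ ≤ ρ := by
  have hK : 0 < K := lt_of_lt_of_le one_pos hH.one_le_K
  set ρ₁ := ρ / K
  have hρ₁ : 0 < ρ₁ := by positivity
  have hKρ : K * ρ₁ = ρ := by simp only [ρ₁]; field_simp
  have hρ₁ρ : ρ₁ ≤ ρ := div_le_self hρ.le hH.one_le_K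
  -- This annulus of the section is disjoint from `S` by isolation, so the trajectory eventually
  -- avoids it. One step of `H` multiplies norms by at most `K`, and `K * ρ₁ = ρ`, so the returns
  -- cannot jump over the annulus.
  set C : Set M := σ '' (Metric.closedBall 0 ρ \ Metric.ball 0 ρ₁)
  have hC : IsClosed C := by
    refine (IsCompact.image_of_continuousOn ?_ (h.cont.mono ?_)).isClosed
    · exact (isCompact_closedBall _ _).diff Metric.isOpen_ball
    · exact sdiff_subset.trans (Metric.closedBall_subset_ball hρr)
  have hSC : Cᶜ ∈ 𝓝ˢ S := by
    refine hC.isOpen_compl.mem_nhdsSet.2 ?_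
    rintro y hy ⟨z, ⟨hz, hz'⟩, rfl⟩
    have hzr : ‖z‖ < r := (mem_closedBall_zero_iff.1 hz).trans_lt hρr
    have := hiso z hzr (IsPeriodicOrbit.subset_nonwanderingSet ⟨p, T, hS⟩ hy)
    subst this
    exact hz' (by simpa using hρ₁)
  obtain ⟨t₀, ht₀⟩ := eventually_atTop.1 ((show Tendsto _ _ _ from hx).eventually hSC)
  -- The extra unit of time ensures that sliding back to the section, by a time less than `1`, does
  -- not go before `max t₀ 0`.
  obtain ⟨t, ht, s, w, hs, hw, he⟩ :=
    hS.exists_flow_mem hx (h.box 1 one_pos ρ₁ hρ₁) (max t₀ 0 + 1)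
  have hs' := abs_lt.1 hs
  have hst : max t₀ 0 ≤ -s + t := by linarith
  have hw' : f (-s + t) x = σ w := by rw [f.map_add, ← he, f.neg_map_map]
  refine ⟨-s + t, (le_max_right _ _).trans hst, w, hw', ?_⟩
  have key : ∀ k, ∀ j ≤ k, ‖H^[j] w‖ < ρ₁ := by
    intro k
    induction k with
    | zero =>
      intro j hj
      obtain rfl : j = 0 := by omega
      simpa using hw
    | succ k ih =>
      intro j hj
      rcases Nat.lt_or_ge j (k + 1) with hjk | hjk
      · exact ih j (by omega)
      obtain rfl : j = k + 1 := by omega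
      obtain ⟨t', ht', he'⟩ := h.exists_iterate_time (k + 1) (y := w)
        fun i hi => (ih i (by omega)).trans_le (hρ₁ρ.trans hρr.le)
      have ht'0 : 0 ≤ t' := le_trans (by have := h.θ_pos; positivity) ht'
      have hmem := ht₀ (t' + (-s + t)) (by linarith [le_max_left t₀ 0])
      rw [f.map_add, hw', he'] at hmem
      by_contra hcon
      refine hmem ⟨_, ⟨?_, ?_⟩, rfl⟩
      · rw [mem_closedBall_zero_iff, Function.iterate_succ_apply', ← hKρ]
        have := hH.lip (H^[k] w) 0
        rw [hH.zero, sub_zero, sub_zero] at this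
        exact this.trans (mul_le_mul_of_nonneg_left (ih k le_rfl).le hK.le)
      · rwa [mem_ball_zero_iff]
  exact fun k => (key k k le_rfl).le.trans hρ₁ρ

/-- Points homoclinic to a saddle orbit are nonwandering. -/
theorem mem_nonwanderingSet_of_homoclinic (h : IsFlowSection f p θ σ H τ r)
    (hH : FlipSaddle H l m K) (hS : IsPeriodicOrbitAt f S p T)
    (hiso : ∀ y, ‖y‖ < r → σ y ∈ nonwanderingSet f → y = 0) {δ : ℝ} (hδ : 0 < δ) (hδr : 3 * δ < r)
    {e : ℝ × ℝ} (he : ‖e‖ ≤ δ) (hback : ∀ n, ∃ e₀, ‖e₀‖ ≤ δ ∧ H^[n] e₀ = e)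
    (hes : σ e ∈ stableManifold f S) : σ e ∈ nonwanderingSet f := by
  obtain ⟨t, ht, w, htw, hw⟩ :=
    h.exists_local_of_mem_stableManifold hH hS hiso hes hδ (by linarith)
  intro U hU t₀
  have hw0 : ‖w‖ ≤ δ := hw 0
  have h1 : ∀ᶠ u in 𝓝 w, f (-t) (σ u) ∈ U := by
    have : ContinuousAt (fun u => f (-t) (σ u)) w :=
      ContinuousAt.comp (g := f (-t)) (f.continuous_toFun (-t)).continuousAt
        (h.continuousAt (by linarith))
    refine this.eventually_mem ?_
    rwa [← htw, f.neg_map_map]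
  have h2 : ∀ᶠ u in 𝓝 e, σ u ∈ U := (h.continuousAt (by linarith)).eventually_mem hU
  obtain ⟨η, hη, hηU⟩ := Metric.eventually_nhds_iff.1 h1
  obtain ⟨η', hη', hηU'⟩ := Metric.eventually_nhds_iff.1 h2
  have e1 : ∀ᶠ n : ℕ in atTop, 2 * δ ≤ m ^ n * (η / 2) :=
    ((tendsto_pow_atTop_atTop_of_one_lt hH.lt_m).atTop_mul_const (half_pos hη)).eventually_ge_atTop
      _
  have e2 : ∀ᶠ n : ℕ in atTop, l ^ n * (4 * δ) < η' := by
    have := (tendsto_pow_atTop_nhds_zero_of_lt_one hH.l_nonneg hH.l_lt).mul_const (4 * δ)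
    rw [zero_mul] at this
    exact this.eventually_lt_const hη'
  have e3 : ∀ᶠ n : ℕ in atTop, t₀ ≤ n * (θ / 2) :=
    (tendsto_natCast_atTop_atTop.atTop_mul_const (half_pos h.θ_pos)).eventually_ge_atTop _
  obtain ⟨n, ⟨hn1, hn2⟩, hn3⟩ := ((e1.and e2).and e3).exists
  -- As in the inclination lemma: a point `u` close to `w`, hence whose backward image by time `t`
  -- is close to `σ e`, is carried by `n` returns close to `e`. So `U` returns to itself after a
  -- long time.
  obtain ⟨e₀, he₀, rfl⟩ := hback n
  obtain ⟨u, hu1, hu2, hu3, hu4⟩ :=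
    hH.exists_vertical_preimage (fun k _ => hw k) he₀ he (half_pos hη).le hn1
  obtain ⟨t', ht', htu⟩ := h.exists_iterate_time n fun k hk => (hu3 k hk.le).trans_lt hδr
  refine ⟨t' + t, by linarith, σ (H^[n] u), ⟨f (-t) (σ u), hηU ?_, ?_⟩, hηU' ?_⟩
  · rw [dist_eq_norm, Prod.norm_def]
    have : (u - w).1 = 0 := by simp [hu1]
    rw [this, norm_zero]
    exact max_lt hη (lt_of_le_of_lt hu2 (half_lt_self hη))
  · rw [f.map_add, f.map_neg_map, htu]
  · rw [dist_eq_norm]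
    exact hu4.trans_lt hn2

variable [CompactSpace M]

/-- Close to a saddle orbit, only its local stable manifold converges to it. -/
theorem exists_forall_notMem_stableManifold (h : IsFlowSection f p θ σ H τ r)
    (hH : FlipSaddle H l m K) (hS : IsPeriodicOrbitAt f S p T) (hd : IsOrbitDecomposition f P)
    (hiso : ∀ y, ‖y‖ < r → σ y ∈ nonwanderingSet f → y = 0)
    (hother : ∀ O ∈ P, O ≠ S → IsOpen (stableManifold f O) ∨ stableManifold f O ⊆ O)
    {s : ℝ} (hs : s = 1 ∨ s = -1) :
    ∃ ρ, 0 < ρ ∧ ∀ z ∈ coneEntering H s, ‖z‖ < ρ → σ z ∉ stableManifold f S := by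
  by_contra! hcon
  have hSP : S ∈ P := hd.mem_of_isPeriodicOrbit ⟨p, T, hS⟩
  have hr := h.r_pos
  have hK : 0 < K := lt_of_lt_of_le one_pos hH.one_le_K
  obtain ⟨δ, hδ, hδr⟩ : ∃ δ : ℝ, 0 < δ ∧ 3 * δ < r := ⟨r / 4, by linarith, by linarith⟩
  -- Since norms grow at most by `K` per step, a start in the ball of radius `δ / K ^ k` forces at
  -- least `k` steps before exit from the `δ`-ball. The last iterate before exit has norm at least
  -- `δ / K`.
  choose z hz hzn hzS using fun k : ℕ => hcon (δ / K ^ k) (by positivity)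
  have hexit : ∀ k, ∃ q, k ≤ q ∧ (∀ j ≤ q, ‖H^[j] (z k)‖ ≤ δ) ∧ δ / K ≤ ‖H^[q] (z k)‖ := by
    intro k
    classical
    have hex := hH.escape hs (hz k) δ
    have hN := Nat.find_spec hex
    have hmin : ∀ j < Nat.find hex, ‖H^[j] (z k)‖ ≤ δ := fun j hj => not_lt.1 (Nat.find_min hex hj)
    set N := Nat.find hex
    have hkN : k < N := by
      by_contra hle
      have h1 := hH.norm_iterate_le N (z k)
      have h2 : K ^ N * ‖z k‖ ≤ K ^ k * (δ / K ^ k) :=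
        mul_le_mul (pow_le_pow_right₀ hH.one_le_K (not_lt.1 hle)) (hzn k).le (norm_nonneg _)
          (by positivity)
      have h3 : K ^ k * (δ / K ^ k) = δ := by field_simp
      linarith
    refine ⟨N - 1, by omega, fun j hj => hmin j (by omega), ?_⟩
    rw [div_le_iff₀ hK]
    have h1 := hH.lip (H^[N - 1] (z k)) 0
    rw [hH.zero, sub_zero, sub_zero, ← Function.iterate_succ_apply' H,
      show (N - 1).succ = N by omega] at h1
    linarith
  choose q hkq hq1 hq2 using hexit
  -- The limit `e` of the last points before exit is nonzero and has preimages of every order in the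
  -- `δ`-ball: it plays the role of a point of the local unstable manifold.
  obtain ⟨e, he, φ, hφ, hlim⟩ := (isCompact_closedBall (0 : ℝ × ℝ) δ).tendsto_subseq
    (x := fun k => H^[q k] (z k)) fun k => mem_closedBall_zero_iff.2 (hq1 k _ le_rfl)
  rw [mem_closedBall_zero_iff] at he
  have he0 : e ≠ 0 := by
    rintro rfl
    have h1 : δ / K ≤ ‖(0 : ℝ × ℝ)‖ :=
      ge_of_tendsto hlim.norm (Eventually.of_forall fun k => hq2 (φ k))
    rw [norm_zero] at h1
    have : 0 < δ / K := by positivity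
    linarith
  have her : ‖e‖ < r := by linarith
  have hback : ∀ n, ∃ e₀, ‖e₀‖ ≤ δ ∧ H^[n] e₀ = e := by
    intro n
    have hcl : IsClosed (H^[n] '' Metric.closedBall 0 δ) :=
      ((isCompact_closedBall _ _).image (hH.continuous.iterate n)).isClosed
    have : e ∈ H^[n] '' Metric.closedBall 0 δ := by
      refine hcl.mem_of_tendsto hlim ?_
      filter_upwards [eventually_ge_atTop n] with k hk
      have hnq : n ≤ q (φ k) := hk.trans ((hφ.id_le k).trans (hkq _))
      refine ⟨H^[q (φ k) - n] (z (φ k)),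
        mem_closedBall_zero_iff.2 (hq1 _ _ (Nat.sub_le _ _)), ?_⟩
      rw [← Function.iterate_add_apply, Nat.add_sub_cancel' hnq]
      rfl
    obtain ⟨e₀, h1, h2⟩ := this
    exact ⟨e₀, mem_closedBall_zero_iff.1 h1, h2⟩
  -- If `O = S`, then `σ e` is homoclinic, hence nonwandering, against isolation. If the basin of
  -- `O` is open, it captures some `z k`, which converges to `S`. Otherwise `σ e` lies on `O` and is
  -- again nonwandering.
  obtain ⟨O, hO, heO⟩ := hd.exists_mem_stableManifold (σ e)
  by_cases hOS : O = S
  · subst hOS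
    exact he0 (hiso e her (h.mem_nonwanderingSet_of_homoclinic hH hS hiso hδ hδr he hback heO))
  rcases hother O hO hOS with hopen | hsub
  · have hev : ∀ᶠ k in atTop, σ (H^[q (φ k)] (z (φ k))) ∈ stableManifold f O :=
      ((h.continuousAt her).tendsto.comp hlim).eventually_mem (hopen.mem_nhds heO)
    obtain ⟨k, hk⟩ := hev.exists
    obtain ⟨t, -, ht⟩ := h.exists_iterate_time (q (φ k)) (y := z (φ k))
      fun j hj => (hq1 _ j hj.le).trans_lt (by linarith)
    rw [← ht, flow_mem_stableManifold] at hk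
    exact hOS (hd.eq_of_mem_stableManifold hO hSP hk (hzS _))
  · exact he0 (hiso e her ((hd.periodic O hO).subset_nonwanderingSet (hsub heO)))

/-- A neighbourhood of a flip saddle is covered by its stable manifold and by a single basin. -/
theorem exists_unique_basin (h : IsFlowSection f p θ σ H τ r)
    (hH : FlipSaddle H l m K) (hS : IsPeriodicOrbitAt f S p T) (hd : IsOrbitDecomposition f P)
    (hiso : ∀ y, ‖y‖ < r → σ y ∈ nonwanderingSet f → y = 0) {sinks : Set (Set M)}
    (hsinks : ∀ O ∈ sinks, IsOpen (stableManifold f O))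
    (hother : ∀ O ∈ P, O ≠ S → O ∈ sinks ∨ stableManifold f O ⊆ O) :
    ∃ A ∈ sinks, A ∈ P ∧ stableManifold f S ∪ stableManifold f A ∈ 𝓝 p := by
  have hK : 0 < K := lt_of_lt_of_le one_pos hH.one_le_K
  have hother' : ∀ O ∈ P, O ≠ S → IsOpen (stableManifold f O) ∨ stableManifold f O ⊆ O :=
    fun O hO hOS => (hother O hO hOS).imp_left (hsinks O)
  obtain ⟨ρ₁, hρ₁, h₁⟩ :=
    h.exists_forall_notMem_stableManifold hH hS hd hiso hother' (s := 1) (Or.inl rfl)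
  obtain ⟨ρ₂, hρ₂, h₂⟩ :=
    h.exists_forall_notMem_stableManifold hH hS hd hiso hother' (s := -1) (Or.inr rfl)
  obtain ⟨ρ, hρ, hρr, hnot⟩ : ∃ ρ, 0 < ρ ∧ ρ ≤ r ∧ ∀ s : ℝ, (s = 1 ∨ s = -1) →
      ∀ z ∈ coneEntering H s, ‖z‖ < ρ → σ z ∉ stableManifold f S := by
    refine ⟨min r (min ρ₁ ρ₂), lt_min h.r_pos (lt_min hρ₁ hρ₂), min_le_left _ _, ?_⟩
    rintro s (rfl | rfl) z hz hzn
    · exact h₁ z hz (hzn.trans_le ((min_le_right _ _).trans (min_le_left _ _)))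
    · exact h₂ z hz (hzn.trans_le ((min_le_right _ _).trans (min_le_right _ _)))
  have hbasin : ∀ s : ℝ, (s = 1 ∨ s = -1) → ∀ z ∈ coneEntering H s, ‖z‖ < ρ →
      ∃ O ∈ P ∩ sinks, σ z ∈ stableManifold f O := by
    intro s hs z hz hzn
    obtain ⟨O, hO, hzO⟩ := hd.exists_mem_stableManifold (σ z)
    have hOS : O ≠ S := by
      rintro rfl
      exact hnot s hs z hz hzn hzO
    refine ⟨O, ⟨hO, (hother O hO hOS).resolve_right fun hsub => ?_⟩, hzO⟩
    have := hiso z (hzn.trans_le hρr) ((hd.periodic O hO).subset_nonwanderingSet (hsub hzO))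
    subst this
    obtain ⟨k, hk⟩ := hz
    simp [hH.iterate_zero] at hk
  -- The basins of sinks are open and pairwise disjoint, so a connected side of the local stable
  -- manifold cannot meet two of them.
  have hconn : ∀ s : ℝ, (s = 1 ∨ s = -1) → ∀ A ∈ P ∩ sinks, ∀ z₀ ∈ coneEntering H s, ‖z₀‖ < ρ →
      σ z₀ ∈ stableManifold f A →
      ∀ z ∈ coneEntering H s, ‖z‖ < ρ → σ z ∈ stableManifold f A := by
    intro s hs A hA z₀ hz₀ hz₀n hz₀A z hz hzn
    have hpre := (hH.isPreconnected_coneEntering_inter_ball hs hρ).image σ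
      (h.cont.mono (inter_subset_right.trans (Metric.ball_subset_ball hρr)))
    have hsub : σ '' (coneEntering H s ∩ Metric.ball 0 ρ) ⊆ stableManifold f A := by
      refine IsPreconnected.subset_left_of_subset_union (hsinks A hA.2)
        (v := ⋃ O ∈ (P ∩ sinks) \ {A}, stableManifold f O)
        (isOpen_biUnion fun O hO => hsinks O hO.1.2) ?_ ?_
        ⟨σ z₀, ⟨z₀, ⟨hz₀, mem_ball_zero_iff.2 hz₀n⟩, rfl⟩, hz₀A⟩ hpre
      · rw [Set.disjoint_left]
        intro x hxA hx
        obtain ⟨O, hO, hxO⟩ := mem_iUnion₂.1 hx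
        exact hO.2 (hd.eq_of_mem_stableManifold hO.1.1 hA.1 hxO hxA)
      · rintro _ ⟨y, ⟨hy, hyn⟩, rfl⟩
        obtain ⟨O, hO, hyO⟩ := hbasin s hs y hy (mem_ball_zero_iff.1 hyn)
        by_cases hOA : O = A
        · exact Or.inl (hOA ▸ hyO)
        · exact Or.inr (mem_iUnion₂.2 ⟨O, ⟨hO, hOA⟩, hyO⟩)
    exact hsub ⟨z, ⟨hz, mem_ball_zero_iff.2 hzn⟩, rfl⟩
  -- The height is small enough that `H z₀` is still in the `ρ`-ball. As `z₀` and `H z₀` lie on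
  -- opposite sides and on the same trajectory, the two sides share one basin.
  set z₀ : ℝ × ℝ := (0, ρ / K / 2)
  have hz₀norm : ‖z₀‖ < ρ / K := by
    have : 0 < ρ / K := by positivity
    simp only [z₀, Prod.norm_def, norm_zero, Real.norm_eq_abs]
    rw [abs_of_pos (by linarith), max_eq_right (by linarith)]
    linarith
  have hz₀n : ‖z₀‖ < ρ := hz₀norm.trans_le (div_le_self hρ.le hH.one_le_K)
  have hz₀mem : z₀ ∈ coneEntering H 1 := by
    have : 0 < ρ / K / 2 := by positivity
    exact ⟨0, by simpa [z₀] using this⟩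
  obtain ⟨A, hA, hz₀A⟩ := hbasin 1 (Or.inl rfl) z₀ hz₀mem hz₀n
  have hHz₀ : H z₀ ∈ coneEntering H (-1) := hH.coneEntering_map (Or.inl rfl) hz₀mem
  have hHz₀n : ‖H z₀‖ < ρ := by
    have := hH.lip z₀ 0
    rw [hH.zero, sub_zero, sub_zero] at this
    refine this.trans_lt ?_
    rw [lt_div_iff₀ hK] at hz₀norm
    linarith
  have hHz₀A : σ (H z₀) ∈ stableManifold f A := by
    rwa [← h.return_eq z₀ (hz₀n.trans_le hρr), flow_mem_stableManifold]
  refine ⟨A, hA.2, hA.1, ?_⟩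
  filter_upwards [h.box 1 one_pos ρ hρ] with x ⟨t, y, _, hy, hx⟩
  rw [← hx, mem_union, flow_mem_stableManifold, flow_mem_stableManifold]
  rcases mem_cone_trichotomy H y with hy' | hy' | hy'
  · left
    have hle := hH.norm_le_of_coneAvoiding hy'
    refine h.mem_stableManifold_of_tendsto hd hS (fun k => ?_) ?_
    · refine (hle k).trans_lt (lt_of_le_of_lt ?_ (hy.trans_le hρr))
      exact mul_le_of_le_one_left (norm_nonneg _) (pow_le_one₀ hH.l_nonneg hH.l_lt.le)
    · refine squeeze_zero_norm hle ?_
      simpa using (tendsto_pow_atTop_nhds_zero_of_lt_one hH.l_nonneg hH.l_lt).mul_const ‖y‖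
  · exact Or.inr (hconn 1 (Or.inl rfl) A hA z₀ hz₀mem hz₀n hz₀A y hy' hy)
  · exact Or.inr (hconn (-1) (Or.inr rfl) A hA _ hHz₀ hHz₀n hHz₀A y hy' hy)

end IsFlowSection

end Saddle

/-! ### Uniqueness of the sink by connectedness -/

section Connectivity

variable {M : Type*} [TopologicalSpace M]

/-- `O` has a local section which meets the nonwandering set in a single point. -/
def HasIsolatingSection (f : Flow ℝ M) (O : Set M) : Prop :=
  ∃ p ∈ O, ∃ (σ : ℝ × ℝ → M) (ρ : ℝ), 0 < ρ ∧ σ 0 = p ∧ ContinuousOn σ (Metric.ball 0 ρ) ∧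
    (∀ y, ‖y‖ < ρ → σ y ∈ nonwanderingSet f → y = 0) ∧
    {x | ∃ t y, ‖y‖ < ρ ∧ f t (σ y) = x} ∈ 𝓝 p

/-- An invariant open partition of the complement of a union `K` of periodic orbits cannot be
nontrivial on both sides of an orbit of `K`, since punctured sections are connected. -/
theorem HasIsolatingSection.dichotomy {f : Flow ℝ M} {O : Set M} (h : HasIsolatingSection f O)
    (hO : IsPeriodicOrbit f O) {U V K : Set M} (hU : IsOpen U) (hV : IsOpen V)
    (hUV : Disjoint U V) (hKΩ : K ⊆ nonwanderingSet f) (hOK : O ⊆ K)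
    (hcov : ∀ x, x ∈ U ∨ x ∈ V ∨ x ∈ K) (hUi : ∀ t x, x ∈ U → f t x ∈ U)
    (hVi : ∀ t x, x ∈ V → f t x ∈ V) (hKi : ∀ t x, x ∈ K → f t x ∈ K) {q : M} (hq : q ∈ O) :
    (U ∪ K ∈ 𝓝 q ∨ V ∪ K ∈ 𝓝 q) ∧ ¬ (U ∪ K ∈ 𝓝 q ∧ V ∪ K ∈ 𝓝 q) := by
  obtain ⟨p, hpO, σ, ρ, hρ, hσ0, hσ, hiso, hbox⟩ := h
  have hmove : ∀ {x y : M}, x ∈ O → y ∈ O → ∀ {E : Set M}, (∀ t x, x ∈ E → f t x ∈ E) → E ∈ 𝓝 x →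
      E ∈ 𝓝 y := by
    intro x y hx hy E hE hEx
    rw [hO.eq_range hx] at hy
    obtain ⟨t, rfl⟩ := hy
    filter_upwards [f.image_mem_nhds t hEx] with z hz
    simpa [f.map_neg_map] using hE t _ hz
  have hUKi : ∀ t x, x ∈ U ∪ K → f t x ∈ U ∪ K := fun t x hx => hx.imp (hUi t x) (hKi t x)
  have hVKi : ∀ t x, x ∈ V ∪ K → f t x ∈ V ∪ K := fun t x hx => hx.imp (hVi t x) (hKi t x)
  have hnotK : ∀ y, ‖y‖ < ρ → y ≠ 0 → σ y ∉ K := fun y hy hy0 hK => hy0 (hiso y hy (hKΩ hK))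
  constructor
  · have hpre := (isPreconnected_ball_diff_zero hρ).image σ (hσ.mono sdiff_subset)
    have hsub : σ '' (Metric.ball 0 ρ \ {0}) ⊆ U ∪ V := by
      rintro _ ⟨y, ⟨hy, hy0⟩, rfl⟩
      rcases hcov (σ y) with h | h | h
      · exact Or.inl h
      · exact Or.inr h
      · exact absurd h (hnotK y (mem_ball_zero_iff.1 hy) hy0)
    have hfin : ∀ E : Set M, (∀ t x, x ∈ E → f t x ∈ E) → σ '' (Metric.ball 0 ρ \ {0}) ⊆ E →
        E ∪ K ∈ 𝓝 p := by
      intro E hE hsubE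
      filter_upwards [hbox] with x ⟨t, y, hy, hx⟩
      rw [← hx]
      by_cases hy0 : y = 0
      · subst hy0
        exact Or.inr (hKi t _ (hOK (hσ0 ▸ hpO)))
      · exact Or.inl (hE t _ (hsubE ⟨y, ⟨mem_ball_zero_iff.2 hy, hy0⟩, rfl⟩))
    rcases hpre.subset_or_subset hU hV hUV hsub with h | h
    · exact Or.inl (hmove hpO hq hUKi (hfin U hUi h))
    · exact Or.inr (hmove hpO hq hVKi (hfin V hVi h))
  · rintro ⟨h1, h2⟩
    have h1 := hmove hq hpO hUKi h1
    have h2 := hmove hq hpO hVKi h2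
    have hcont : ContinuousAt σ 0 :=
      hσ.continuousAt (Metric.isOpen_ball.mem_nhds (Metric.mem_ball_self hρ))
    have hev : ∀ᶠ y in 𝓝 (0 : ℝ × ℝ), σ y ∈ (U ∪ K) ∩ (V ∪ K) :=
      hcont.eventually_mem (hσ0 ▸ inter_mem h1 h2)
    have hev' := hev.and (Metric.ball_mem_nhds (0 : ℝ × ℝ) hρ)
    -- A nonzero point of the section near `0` is not in `K`, so it would lie in both of the
    -- disjoint sets `U` and `V`.
    obtain ⟨y, ⟨⟨hyU, hyV⟩, hyρ⟩, hy0⟩ :=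
      ((hev'.filter_mono nhdsWithin_le_nhds).and
        (self_mem_nhdsWithin (s := {(0 : ℝ × ℝ)}ᶜ))).exists
    have hyK := hnotK y (mem_ball_zero_iff.1 hyρ) hy0
    exact Set.disjoint_left.1 hUV (hyU.resolve_right hyK) (hyV.resolve_right hyK)

variable [T2Space M] [CompactSpace M] [ConnectedSpace M]

/-- If a single basin is adjacent to the only saddle, then it belongs to the only attractor. -/
theorem IsOrbitDecomposition.sinks_eq_singleton {f : Flow ℝ M} {P sinks sources : Set (Set M)}
    (hd : IsOrbitDecomposition f P) {S A : Set M} {p : M} {T : ℝ} (hS : IsPeriodicOrbitAt f S p T)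
    (hP : P = insert S (sinks ∪ sources)) (hSsinks : S ∉ sinks)
    (hsinks : ∀ O ∈ sinks, IsOpen (stableManifold f O))
    (hsources : ∀ O ∈ sources, stableManifold f O ⊆ O ∧ HasIsolatingSection f O)
    (hA : A ∈ sinks) (hSA : stableManifold f S ∪ stableManifold f A ∈ 𝓝 p) : sinks = {A} := by
  have hsinksP : sinks ⊆ P := hP ▸ subset_union_left.trans (subset_insert _ _)
  have hsourcesP : sources ⊆ P := hP ▸ subset_union_right.trans (subset_insert _ _)
  have hSP : S ∈ P := hP ▸ mem_insert _ _
  refine Subset.antisymm (fun A' hA' => ?_) (singleton_subset_iff.2 hA)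
  by_contra hne
  set U := stableManifold f S ∪ stableManifold f A
  set V := ⋃ O ∈ sinks \ {A}, stableManifold f O
  set K := ⋃₀ sources
  have hUi : ∀ t x, x ∈ U → f t x ∈ U := fun t x hx =>
    hx.imp (flow_mem_stableManifold t).2 (flow_mem_stableManifold t).2
  have hVi : ∀ t x, x ∈ V → f t x ∈ V := by
    intro t x hx
    obtain ⟨O, hO, hxO⟩ := mem_iUnion₂.1 hx
    exact mem_iUnion₂.2 ⟨O, hO, (flow_mem_stableManifold t).2 hxO⟩
  have hKi : ∀ t x, x ∈ K → f t x ∈ K := by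
    rintro t x ⟨O, hO, hxO⟩
    exact ⟨O, hO, (hd.periodic O (hsourcesP hO)).flow_mem hxO t⟩
  have hU : IsOpen U := by
    refine isOpen_iff_mem_nhds.2 fun x hx => ?_
    rcases hx with hx | hx
    · exact hS.mem_nhds_of_invariant hUi hSA hx
    · exact mem_of_superset ((hsinks A hA).mem_nhds hx) subset_union_right
  have hV : IsOpen V := isOpen_biUnion fun O hO => hsinks O hO.1
  have hUV : Disjoint U V := by
    rw [Set.disjoint_left]
    intro x hxU hxV
    obtain ⟨O, hO, hxO⟩ := mem_iUnion₂.1 hxV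
    rcases hxU with hx | hx
    · exact hSsinks (hd.eq_of_mem_stableManifold hSP (hsinksP hO.1) hx hxO ▸ hO.1)
    · exact hO.2 (hd.eq_of_mem_stableManifold (hsinksP hO.1) (hsinksP hA) hxO hx)
  have hcov : ∀ x, x ∈ U ∨ x ∈ V ∨ x ∈ K := by
    intro x
    obtain ⟨O, hO, hxO⟩ := hd.exists_mem_stableManifold x
    rw [hP] at hO
    rcases hO with rfl | hO | hO
    · exact Or.inl (Or.inl hxO)
    · by_cases hOA : O = A
      · exact Or.inl (Or.inr (hOA ▸ hxO))
      · exact Or.inr (Or.inl (mem_iUnion₂.2 ⟨O, ⟨hO, hOA⟩, hxO⟩))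
    · exact Or.inr (Or.inr ⟨O, hO, (hsources O hO).1 hxO⟩)
  have hKΩ : K ⊆ nonwanderingSet f := by
    rw [hd.eq_sUnion]
    exact sUnion_subset_sUnion hsourcesP
  have hdich : ∀ q ∈ K, (U ∪ K ∈ 𝓝 q ∨ V ∪ K ∈ 𝓝 q) ∧ ¬ (U ∪ K ∈ 𝓝 q ∧ V ∪ K ∈ 𝓝 q) := by
    rintro q ⟨O, hO, hq⟩
    exact (hsources O hO).2.dichotomy (hd.periodic O (hsourcesP hO)) hU hV hUV hKΩ
      (subset_sUnion_of_mem hO) hcov hUi hVi hKi hq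
  have hUint : U ⊆ interior (U ∪ K) := hU.subset_interior_iff.2 subset_union_left
  have hVint : V ⊆ interior (V ∪ K) := hV.subset_interior_iff.2 subset_union_left
  -- Each source is absorbed into the side that surrounds it. The two interiors then cover `M` and
  -- are disjoint, since no point of `K` can be surrounded by both sides.
  have hcover : (univ : Set M) ⊆ interior (U ∪ K) ∪ interior (V ∪ K) := by
    intro x _
    rcases hcov x with h | h | h
    · exact Or.inl (hUint h)
    · exact Or.inr (hVint h)
    · exact (hdich x h).1.imp mem_interior_iff_mem_nhds.2 mem_interior_iff_mem_nhds.2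
  have hUne : U.Nonempty := ⟨p, mem_of_mem_nhds hSA⟩
  have hVne : V.Nonempty := by
    obtain ⟨p', T', hp'⟩ := hd.periodic A' (hsinksP hA')
    exact ⟨p', mem_iUnion₂.2 ⟨A', ⟨hA', hne⟩,
      (hd.periodic A' (hsinksP hA')).subset_stableManifold hp'.base_mem⟩⟩
  obtain ⟨x, -, hx1, hx2⟩ := isPreconnected_univ (α := M) _ _ isOpen_interior isOpen_interior hcover
    (by simpa using hUne.mono hUint) (by simpa using hVne.mono hVint)
  by_cases hxK : x ∈ K
  · exact (hdich x hxK).2 ⟨mem_interior_iff_mem_nhds.1 hx1, mem_interior_iff_mem_nhds.1 hx2⟩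
  · exact Set.disjoint_left.1 hUV ((interior_subset hx1).resolve_right hxK)
      ((interior_subset hx2).resolve_right hxK)

end Connectivity

/-! ### Sources through time reversal -/

section Sources

variable {M : Type*} [TopologicalSpace M] {f : Flow ℝ M}

theorem Flow.reverse_reverse (f : Flow ℝ M) : f.reverse.reverse = f := by
  ext t x
  simp [Flow.reverse_apply]

/-- Nothing converges to an orbit which is asymptotically stable in reversed time. -/
theorem stableManifold_subset_of_reverse_stable [T2Space M] {O : Set M} {p : M} {T : ℝ}
    (hO : IsPeriodicOrbitAt f O p T)
    (h : ∀ U ∈ 𝓝ˢ O, ∃ V ∈ 𝓝 p, ∀ x ∈ V, ∀ t, 0 ≤ t → f.reverse t x ∈ U) :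
    stableManifold f O ⊆ O := by
  intro x hx
  by_contra hxO
  -- Stability in reversed time confines backward trajectories from `V` to the complement of `x`;
  -- but a forward iterate of `x` lies in `V`, and its backward trajectory passes through `x`.
  obtain ⟨V, hV, hVU⟩ := h {x}ᶜ (isOpen_compl_singleton.mem_nhdsSet.2 fun y hy hyx => hxO (hyx ▸ hy))
  obtain ⟨t, ht, htV⟩ := hO.exists_flow_mem hx hV 0
  exact hVU _ htV t ht (f.neg_map_map t x)

theorem IsFlowSection.hasIsolatingSection_of_reverse [T2Space M] {P : Set (Set M)} {O : Set M}
    {p : M} {T θ : ℝ} {σ : ℝ × ℝ → M} {G : ℝ × ℝ → ℝ × ℝ} {τ : ℝ × ℝ → ℝ} {r : ℝ}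
    (h : IsFlowSection f.reverse p θ σ G τ r) (hd : IsOrbitDecomposition f P)
    (hO : IsPeriodicOrbitAt f O p T) : HasIsolatingSection f O := by
  obtain ⟨ρ, hρ, hρr, hiso⟩ := h.exists_isolating hd.reverse hO.reverse
  rw [nonwanderingSet_reverse] at hiso
  refine ⟨p, hO.base_mem, σ, ρ, hρ, h.zero, h.cont.mono (Metric.ball_subset_ball hρr), hiso, ?_⟩
  filter_upwards [h.box 1 one_pos ρ hρ] with x ⟨t, y, _, hy, hx⟩
  exact ⟨-t, y, hy, hx⟩

end Sources

noncomputable section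

/-! ### The flow and its differential in a chart -/

section FlowInChart

variable {M : Type*} [TopologicalSpace M] [ChartedSpace E3 M]

/-- The flow read in the preferred chart at `p`. -/
def flowInChart (f : Flow ℝ M) (p : M) (q : ℝ × E3) : E3 :=
  extChartAt (𝓡 3) p (f q.1 ((extChartAt (𝓡 3) p).symm q.2))

/-- The velocity of the flow at `p`, read in the preferred chart at `p`. -/
def velocity (f : Flow ℝ M) (p : M) : E3 :=
  deriv (fun t : ℝ => extChartAt (𝓡 3) p (f t p)) 0

/-- The derivative at `p` of the time-`θ` map, read in the preferred chart at `p`. -/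
def chartDifferential (f : Flow ℝ M) (p : M) (θ : ℝ) : E3 →L[ℝ] E3 :=
  fderiv ℝ (fun v => flowInChart f p (θ, v)) (extChartAt (𝓡 3) p p)

variable {f : Flow ℝ M} {p : M} {θ : ℝ}

theorem eventually_flow_mem_source (f : Flow ℝ M) (hθ : f θ p ∈ (extChartAt (𝓡 3) p).source) :
    ∀ᶠ q : ℝ × E3 in 𝓝 (θ, extChartAt (𝓡 3) p p),
      f q.1 ((extChartAt (𝓡 3) p).symm q.2) ∈ (extChartAt (𝓡 3) p).source := by
  have h1 : ContinuousAt (fun q : ℝ × E3 => f q.1 ((extChartAt (𝓡 3) p).symm q.2))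
      (θ, extChartAt (𝓡 3) p p) := by
    have h2 : ContinuousAt (fun q : ℝ × E3 => (extChartAt (𝓡 3) p).symm q.2)
        (θ, extChartAt (𝓡 3) p p) :=
      ContinuousAt.comp (g := (extChartAt (𝓡 3) p).symm) (continuousAt_extChartAt_symm p)
        continuousAt_snd
    exact f.cont'.continuousAt.comp (continuousAt_fst.prodMk h2)
  refine h1.eventually_mem ((isOpen_extChartAt_source p).mem_nhds ?_)
  simpa using hθ

variable [IsManifold (𝓡 3) 1 M]

theorem IsC1Flow.contDiffAt_flowInChart (hf : IsC1Flow f)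
    (hθ : f θ p ∈ (extChartAt (𝓡 3) p).source) :
    ContDiffAt ℝ 1 (flowInChart f p) (θ, extChartAt (𝓡 3) p p) := by
  rw [← contMDiffAt_iff_contDiffAt]
  have h1 : ContMDiffAt 𝓘(ℝ, ℝ × E3) (𝓡 3) 1
      (fun q : ℝ × E3 => (extChartAt (𝓡 3) p).symm q.2) (θ, extChartAt (𝓡 3) p p) := by
    have := (contMDiffOn_extChartAt_symm (I := 𝓡 3) (n := 1) p).contMDiffAt
      (extChartAt_target_mem_nhds (I := 𝓡 3) p)
    exact ContMDiffAt.comp (θ, extChartAt (𝓡 3) p p) this contDiff_snd.contMDiff.contMDiffAt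
  have h2 : ContMDiffAt 𝓘(ℝ, ℝ × E3) 𝓘(ℝ, ℝ) 1 (fun q : ℝ × E3 => q.1)
      (θ, extChartAt (𝓡 3) p p) := contDiff_fst.contMDiff.contMDiffAt
  have h3 : ContMDiffAt 𝓘(ℝ, ℝ × E3) (𝓡 3) 1
      (fun q : ℝ × E3 => f q.1 ((extChartAt (𝓡 3) p).symm q.2)) (θ, extChartAt (𝓡 3) p p) :=
    ContMDiffAt.comp (θ, extChartAt (𝓡 3) p p)
      (show ContMDiffAt (𝓘(ℝ, ℝ).prod (𝓡 3)) (𝓡 3) 1 (fun q : ℝ × M => f q.1 q.2) _ from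
        hf.contMDiffAt) (h2.prodMk h1)
  refine ContMDiffAt.comp (θ, extChartAt (𝓡 3) p p) (g := extChartAt (𝓡 3) p) ?_ h3
  refine contMDiffAt_extChartAt' ?_
  simpa using hθ

theorem IsC1Flow.hasFDerivAt_chart (hf : IsC1Flow f)
    (hθ : f θ p ∈ (extChartAt (𝓡 3) p).source) :
    HasFDerivAt (fun v => flowInChart f p (θ, v)) (chartDifferential f p θ)
      (extChartAt (𝓡 3) p p) := by
  have h1 := (hf.contDiffAt_flowInChart hθ).differentiableAt one_ne_zero
  exact (DifferentiableAt.comp (g := flowInChart f p) (extChartAt (𝓡 3) p p) h1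
    ((differentiableAt_const θ).prodMk differentiableAt_id)).hasFDerivAt

theorem IsC1Flow.hasStrictFDerivAt_chart (hf : IsC1Flow f) (hθ : f θ p = p) :
    HasStrictFDerivAt (fun v => flowInChart f p (θ, v)) (chartDifferential f p θ)
      (extChartAt (𝓡 3) p p) := by
  have h1 := hf.contDiffAt_flowInChart (p := p) (θ := θ) (by rw [hθ]; exact mem_extChartAt_source p)
  have h2 : ContDiffAt ℝ 1 (fun v => flowInChart f p (θ, v)) (extChartAt (𝓡 3) p p) :=
    ContDiffAt.comp (g := flowInChart f p) (extChartAt (𝓡 3) p p) h1 (contDiffAt_const.prodMk contDiffAt_id)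
  exact h2.hasStrictFDerivAt one_ne_zero

theorem IsC1Flow.hasDerivAt_velocity (hf : IsC1Flow f) (p : M) :
    HasDerivAt (fun t : ℝ => extChartAt (𝓡 3) p (f t p)) (velocity f p) 0 := by
  have h1 := (hf.contDiffAt_flowInChart (p := p) (θ := 0)
    (by simp)).differentiableAt one_ne_zero
  have h2 : DifferentiableAt ℝ (fun t : ℝ => flowInChart f p (t, extChartAt (𝓡 3) p p)) 0 :=
    DifferentiableAt.comp (g := flowInChart f p) (0 : ℝ) h1 (differentiableAt_id.prodMk (differentiableAt_const _))
  simp only [flowInChart, extChartAt_to_inv] at h2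
  exact h2.hasDerivAt

omit [IsManifold (𝓡 3) 1 M] in
theorem eventually_flow_mem_source_time (f : Flow ℝ M) (p : M) :
    ∀ᶠ t : ℝ in 𝓝 0, f t p ∈ (extChartAt (𝓡 3) p).source := by
  have : ContinuousAt (fun t : ℝ => f t p) 0 := (by fun_prop : Continuous _).continuousAt
  refine this.eventually_mem ?_
  simpa using extChartAt_source_mem_nhds (I := 𝓡 3) p

/-- In the chart, the velocity at `f t p` is the image of the one at `p`. -/
theorem IsC1Flow.hasDerivAt_chart_flow (hf : IsC1Flow f)
    (hθ : f θ p ∈ (extChartAt (𝓡 3) p).source) :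
    HasDerivAt (fun t : ℝ => extChartAt (𝓡 3) p (f (θ + t) p))
      (chartDifferential f p θ (velocity f p)) 0 := by
  have h1 := hf.hasFDerivAt_chart hθ
  have h2 := hf.hasDerivAt_velocity p
  have e : extChartAt (𝓡 3) p p = (fun t : ℝ => extChartAt (𝓡 3) p (f t p)) 0 := by simp
  rw [e] at h1
  refine (h1.comp_hasDerivAt (0 : ℝ) h2).congr_of_eventuallyEq ?_
  filter_upwards [eventually_flow_mem_source_time f p] with t ht
  simp only [Function.comp, flowInChart, (extChartAt (𝓡 3) p).left_inv ht, f.map_add]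

/-- Differentiating `f θ (f t p) = f t p` at `t = 0` gives the trivial multiplier `1`. -/
theorem IsC1Flow.chartDifferential_velocity (hf : IsC1Flow f) (hθ : f θ p = p) :
    chartDifferential f p θ (velocity f p) = velocity f p := by
  have h1 := hf.hasDerivAt_chart_flow (p := p) (θ := θ) (by simp [hθ])
  simp only [add_comm θ, f.map_add, hθ] at h1
  exact h1.unique (hf.hasDerivAt_velocity p)

theorem IsC1Flow.chartDifferential_add (hf : IsC1Flow f) {θ' : ℝ} (hθ : f θ p = p)
    (hθ' : f θ' p = p) :
    chartDifferential f p (θ + θ') = (chartDifferential f p θ).comp (chartDifferential f p θ') := by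
  have h1 := hf.hasFDerivAt_chart (p := p) (θ := θ) (by simp [hθ])
  have h2 := hf.hasFDerivAt_chart (p := p) (θ := θ') (by simp [hθ'])
  have e : extChartAt (𝓡 3) p p = flowInChart f p (θ', extChartAt (𝓡 3) p p) := by
    simp [flowInChart, hθ']
  rw [e] at h1
  refine HasFDerivAt.fderiv ((h1.comp (extChartAt (𝓡 3) p p) h2).congr_of_eventuallyEq ?_)
  have h3 := eventually_flow_mem_source f (p := p) (θ := θ') (by simp [hθ'])
  have h4 : Tendsto (fun v : E3 => (θ', v)) (𝓝 (extChartAt (𝓡 3) p p))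
      (𝓝 (θ', extChartAt (𝓡 3) p p)) := (by fun_prop : Continuous _).tendsto _
  filter_upwards [h4.eventually h3] with v hv
  simp only [Function.comp, flowInChart, f.map_add, (extChartAt (𝓡 3) p).left_inv hv]

omit [IsManifold (𝓡 3) 1 M] in
theorem chartDifferential_zero (f : Flow ℝ M) (p : M) :
    chartDifferential f p 0 = ContinuousLinearMap.id ℝ E3 := by
  refine HasFDerivAt.fderiv ((hasFDerivAt_id _).congr_of_eventuallyEq ?_)
  filter_upwards [extChartAt_target_mem_nhds (I := 𝓡 3) p] with v hv
  simp only [flowInChart, f.map_zero_apply, (extChartAt (𝓡 3) p).right_inv hv, id_eq]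

theorem IsC1Flow.chartDifferential_nat_mul (hf : IsC1Flow f) (hθ : f θ p = p) (n : ℕ) :
    chartDifferential f p (n * θ) = chartDifferential f p θ ^ n := by
  induction n with
  | zero =>
    rw [Nat.cast_zero, zero_mul, chartDifferential_zero, pow_zero]
    rfl
  | succ n ih =>
    push_cast
    rw [add_mul, one_mul, hf.chartDifferential_add (flow_nat_mul_period hθ n) hθ, ih, pow_succ]
    rfl

/-- The intrinsic differential uses the preferred charts at `p` and at `f θ p`. These coincide at a
return time, so the multipliers can be computed in one fixed chart. -/
theorem IsC1Flow.toLinearMap_chartDifferential (hf : IsC1Flow f) (hθ : f θ p = p) :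
    (chartDifferential f p θ).toLinearMap = returnDifferential f p θ := by
  have hC : ContMDiff (𝓡 3) (𝓡 3) 1 (f θ) := by
    have h0 : ContMDiff (𝓡 3) 𝓘(ℝ, ℝ) 1 fun _ : M => θ := contMDiff_const
    exact ContMDiff.comp (g := fun q : ℝ × M => f q.1 q.2)
      (show ContMDiff (𝓘(ℝ, ℝ).prod (𝓡 3)) (𝓡 3) 1 (fun q : ℝ × M => f q.1 q.2) from hf)
      (h0.prodMk contMDiff_id)
  have h1 := (hC.contMDiffAt (x := p)).mdifferentiableAt one_ne_zero
  have h2 := h1.hasMFDerivAt.2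
  rw [ModelWithCorners.range_eq_univ] at h2
  replace h2 := (hasFDerivWithinAt_univ (𝕜 := ℝ) (E := E3) (F := E3)).1 h2
  have e : writtenInExtChartAt (𝓡 3) (𝓡 3) p (f θ) = fun v => flowInChart f p (θ, v) := by
    ext1 v
    simp only [writtenInExtChartAt, flowInChart, Function.comp, hθ]
  rw [e] at h2
  have h3 := h2.unique (hf.hasFDerivAt_chart (p := p) (θ := θ) (by simp [hθ]))
  unfold returnDifferential
  simp only
  rw [← h3]

/-- The velocity does not vanish at a periodic point. -/
theorem IsC1Flow.velocity_ne_zero (hf : IsC1Flow f) {O : Set M} {T : ℝ}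
    (hO : IsPeriodicOrbitAt f O p T) : velocity f p ≠ 0 := by
  intro hv
  obtain ⟨ε, hε, hs⟩ := Metric.eventually_nhds_iff.1 (eventually_flow_mem_source_time f p)
  set c : ℝ → E3 := fun t => extChartAt (𝓡 3) p (f t p)
  -- The chart velocity at `f t p` is the image of the velocity at `p`, hence zero. So the
  -- trajectory is constant for a short time, against the minimality of the period `T`.
  have hder : ∀ t ∈ Metric.ball (0 : ℝ) ε, HasDerivAt c 0 t := by
    intro t ht
    have h1 := hf.hasDerivAt_chart_flow (p := p) (θ := t) (hs ht)
    rw [hv, map_zero] at h1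
    have h2 : HasDerivAt (fun s : ℝ => c (t + s)) 0 (t - t) := by rw [sub_self]; exact h1
    simpa using h2.comp_sub_const t t
  have hmem : min (ε / 2) (T / 2) ∈ Metric.ball (0 : ℝ) ε := by
    have := lt_min (half_pos hε) (half_pos hO.pos)
    rw [mem_ball_zero_iff, Real.norm_eq_abs, abs_of_pos this]
    exact (min_le_left _ _).trans_lt (half_lt_self hε)
  have hc := Metric.isOpen_ball.is_const_of_deriv_eq_zero (convex_ball (0 : ℝ) ε).isPreconnected
    (fun t ht => (hder t ht).differentiableAt.differentiableWithinAt)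
    (fun t ht => (hder t ht).deriv) hmem (Metric.mem_ball_self hε)
  have h0 : c 0 = extChartAt (𝓡 3) p p := by simp [c]
  rw [h0] at hc
  have hfix := (extChartAt (𝓡 3) p).injOn (hs hmem) (mem_extChartAt_source p) hc
  have hpos := lt_min (half_pos hε) (half_pos hO.pos)
  have := hO.1.2 ⟨hpos, hfix⟩
  have := min_le_right (ε / 2) (T / 2)
  linarith [hO.pos]

omit [IsManifold (𝓡 3) 1 M] in
theorem IsC1Flow.reverse (hf : IsC1Flow f) : IsC1Flow f.reverse := by
  have h0 : ContMDiff (𝓘(ℝ, ℝ).prod (𝓡 3)) (𝓘(ℝ, ℝ).prod (𝓡 3)) 1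
      fun q : ℝ × M => (-q.1, q.2) :=
    (contDiff_neg.contMDiff.comp contMDiff_fst).prodMk contMDiff_snd
  exact ContMDiff.comp
    (show ContMDiff (𝓘(ℝ, ℝ).prod (𝓡 3)) (𝓡 3) 1 (fun q : ℝ × M => f q.1 q.2) from hf) h0

omit [IsManifold (𝓡 3) 1 M] in
theorem chartDifferential_reverse (f : Flow ℝ M) (p : M) (θ : ℝ) :
    chartDifferential f.reverse p θ = chartDifferential f p (-θ) := rfl

theorem IsC1Flow.velocity_reverse (hf : IsC1Flow f) (p : M) :
    velocity f.reverse p = -velocity f p := by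
  have h1 := hf.hasDerivAt_velocity p
  rw [← neg_zero] at h1
  have := h1.scomp (0 : ℝ) (hasDerivAt_neg 0)
  rw [neg_one_smul] at this
  exact this.deriv

theorem IsC1Flow.chartDifferential_neg_apply (hf : IsC1Flow f) (hθ : f θ p = p) (v : E3) :
    chartDifferential f p (-θ) (chartDifferential f p θ v) = v := by
  have hθ' : f (-θ) p = p := by simpa [f.neg_map_map] using congrArg (f (-θ)) hθ.symm
  have := hf.chartDifferential_add hθ' hθ
  rw [neg_add_cancel, chartDifferential_zero] at this
  exact (DFunLike.congr_fun this v).symm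

end FlowInChart

/-! ### Construction of cross-sections by the inverse function theorem -/

section SectionConstruction

variable {M : Type*} [TopologicalSpace M] [ChartedSpace E3 M] [IsManifold (𝓡 3) 1 M]
  {f : Flow ℝ M} {p : M} {θ : ℝ}

/-- Flow box coordinates: the derivative of `(t, y) ↦ f t (σ y)` in the chart. -/
theorem IsC1Flow.hasStrictFDerivAt_flowBox (hf : IsC1Flow f) (p : M) (ι : ℝ × ℝ →L[ℝ] E3)
    (Ψ : (ℝ × ℝ × ℝ) ≃L[ℝ] E3) (hΨ : ∀ t y, Ψ (t, y) = t • velocity f p + ι y) :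
    HasStrictFDerivAt
      (fun z : ℝ × ℝ × ℝ => flowInChart f p (z.1, extChartAt (𝓡 3) p p + ι z.2))
      (Ψ : (ℝ × ℝ × ℝ) →L[ℝ] E3) 0 := by
  set c₀ := extChartAt (𝓡 3) p p
  have h1 := (hf.contDiffAt_flowInChart (p := p) (θ := 0) (by simp)).hasStrictFDerivAt one_ne_zero
  set D := fderiv ℝ (flowInChart f p) (0, c₀)
  have hDt : D (1, 0) = velocity f p := by
    have h2 : HasDerivAt (fun t : ℝ => (t, c₀)) ((1 : ℝ), (0 : E3)) 0 :=
      (hasDerivAt_id (0 : ℝ)).prodMk (hasDerivAt_const _ _)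
    have h3 := h1.hasFDerivAt.comp_hasDerivAt (0 : ℝ) h2
    have h4 := hf.hasDerivAt_velocity p
    refine h3.unique (h4.congr_of_eventuallyEq (Eventually.of_forall fun t => ?_))
    simp only [Function.comp, flowInChart, c₀, extChartAt_to_inv]
  have hDv : ∀ v, D (0, v) = v := by
    intro v
    have h2 : HasFDerivAt (fun v : E3 => ((0 : ℝ), v))
        ((0 : E3 →L[ℝ] ℝ).prod (ContinuousLinearMap.id ℝ E3)) c₀ :=
      (hasFDerivAt_const _ _).prodMk (hasFDerivAt_id _)
    have h3 := (HasFDerivAt.comp c₀ (g := flowInChart f p) h1.hasFDerivAt h2).fderiv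
    have h4 := chartDifferential_zero f p
    have h5 := DFunLike.congr_fun (h3.symm.trans h4) v
    simpa using h5
  have hA : HasStrictFDerivAt (fun z : ℝ × ℝ × ℝ => (z.1, c₀ + ι z.2))
      ((ContinuousLinearMap.fst ℝ ℝ (ℝ × ℝ)).prod
        (ι.comp (ContinuousLinearMap.snd ℝ ℝ (ℝ × ℝ)))) 0 :=
    hasStrictFDerivAt_fst.prodMk
      ((ι.comp (ContinuousLinearMap.snd ℝ ℝ (ℝ × ℝ))).hasStrictFDerivAt.const_add c₀)
  have h1' : HasStrictFDerivAt (flowInChart f p) D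
      ((fun z : ℝ × ℝ × ℝ => (z.1, c₀ + ι z.2)) 0) := by
    have e : (fun z : ℝ × ℝ × ℝ => (z.1, c₀ + ι z.2)) 0 = (0, c₀) := by
      simp only [Prod.fst_zero, Prod.snd_zero, map_zero, add_zero]
    rw [e]
    exact h1
  have h6 := h1'.comp (0 : ℝ × ℝ × ℝ) hA
  refine h6.congr_fderiv (ContinuousLinearMap.ext fun z => ?_)
  obtain ⟨t, y⟩ := z
  have e : ((t, ι y) : ℝ × E3) = t • (1, 0) + (0, ι y) := by simp
  simp only [ContinuousLinearEquiv.coe_coe, hΨ, ContinuousLinearMap.comp_apply,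
    ContinuousLinearMap.prod_apply, ContinuousLinearMap.coe_fst', ContinuousLinearMap.coe_snd']
  rw [e, map_add, map_smul, hDt, hDv]

/-- A periodic point has a local section, whose return map has the derivative induced by the
differential of the flow modulo its direction. -/
theorem IsC1Flow.exists_flowSection (hf : IsC1Flow f) (hθ0 : 0 < θ) (hθ : f θ p = p)
    {ι : ℝ × ℝ →L[ℝ] E3} (hι : ∀ (t : ℝ) y, t • velocity f p + ι y = 0 → t = 0 ∧ y = 0)
    {B : ℝ × ℝ →L[ℝ] ℝ × ℝ}
    (hB : ∀ y, ∃ c : ℝ, chartDifferential f p θ (ι y) = c • velocity f p + ι (B y)) :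
    ∃ σ G τ r, IsFlowSection f p θ σ G τ r ∧ HasStrictFDerivAt G B 0 := by
  set φ := extChartAt (𝓡 3) p
  set c₀ := φ p
  set X := velocity f p
  let Ψ₀ : (ℝ × ℝ × ℝ) →ₗ[ℝ] E3 :=
    (LinearMap.toSpanSingleton ℝ E3 X).coprod ι.toLinearMap
  have hΨ₀ : Function.Injective Ψ₀ := by
    rw [injective_iff_map_eq_zero]
    rintro ⟨t, y⟩ hty
    obtain ⟨rfl, rfl⟩ := hι t y hty
    rfl
  let Ψ : (ℝ × ℝ × ℝ) ≃L[ℝ] E3 :=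
    (LinearEquiv.ofInjectiveOfFinrankEq Ψ₀ hΨ₀ (by simp)).toContinuousLinearEquiv
  have hΨ : ∀ t y, Ψ (t, y) = t • X + ι y := fun t y => rfl
  have hstrict := hf.hasStrictFDerivAt_flowBox p ι Ψ hΨ
  set F : ℝ × ℝ × ℝ → E3 := fun z => flowInChart f p (z.1, c₀ + ι z.2)
  have hF0 : F 0 = c₀ := by simp [F, flowInChart, c₀, φ]
  set inv := HasStrictFDerivAt.localInverse F Ψ 0 hstrict
  have hinv : HasStrictFDerivAt inv (Ψ.symm : E3 →L[ℝ] ℝ × ℝ × ℝ) c₀ := hF0 ▸ hstrict.to_localInverse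
  have hleft : ∀ᶠ z in 𝓝 0, inv (F z) = z := hstrict.eventually_left_inverse
  have hright : ∀ᶠ v in 𝓝 c₀, F (inv v) = v := hF0 ▸ hstrict.eventually_right_inverse
  have hinv0 : inv c₀ = 0 := hF0 ▸ hstrict.localInverse_apply_image
  let σ : ℝ × ℝ → M := fun y => φ.symm (c₀ + ι y)
  have hσ0 : σ 0 = p := by simp [σ, c₀, φ]
  have hcι : Continuous fun y => c₀ + ι y := by fun_prop
  have hcι0 : c₀ + ι 0 = c₀ := by rw [map_zero, add_zero]
  have hFσ : ∀ t y, F (t, y) = φ (f t (σ y)) := fun t y => rfl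
  -- `E y` gives the flow-box coordinates of `f θ (σ y)`. Its second component is the return map,
  -- and flowing for `θ` minus its first component lands exactly on the section.
  let E : ℝ × ℝ → ℝ × ℝ × ℝ := fun y => inv (flowInChart f p (θ, c₀ + ι y))
  have hg0 : flowInChart f p (θ, c₀) = c₀ := by simp [flowInChart, c₀, φ, hθ]
  have hE : HasStrictFDerivAt E ((Ψ.symm : E3 →L[ℝ] ℝ × ℝ × ℝ).comp
      ((chartDifferential f p θ).comp ι)) 0 := by
    have h1 : HasStrictFDerivAt (fun y => c₀ + ι y) ι 0 := ι.hasStrictFDerivAt.const_add c₀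
    have h2 : HasStrictFDerivAt (fun v => flowInChart f p (θ, v)) (chartDifferential f p θ)
        ((fun y => c₀ + ι y) 0) := by
      simp only [hcι0]
      exact hf.hasStrictFDerivAt_chart hθ
    have h3 := h2.comp (0 : ℝ × ℝ) h1
    refine HasStrictFDerivAt.comp (g := inv) (0 : ℝ × ℝ) ?_ h3
    simpa [Function.comp, hg0] using hinv
  have hE0 : E 0 = 0 := by simp [E, hg0, hinv0]
  have hEt : Tendsto E (𝓝 0) (𝓝 0) := by simpa [hE0] using hE.continuousAt.tendsto
  have hGder : HasStrictFDerivAt (fun y => (E y).2) B 0 := by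
    have h1 := hE.snd
    refine h1.congr_fderiv (ContinuousLinearMap.ext fun y => ?_)
    obtain ⟨c, hc⟩ := hB y
    simp only [ContinuousLinearMap.comp_apply, hc, ContinuousLinearEquiv.coe_coe,
      ContinuousLinearMap.coe_snd']
    rw [← hΨ c (B y), Ψ.symm_apply_apply]
  have hσc : ∀ᶠ y in 𝓝 (0 : ℝ × ℝ), c₀ + ι y ∈ φ.target :=
    by
    refine hcι.continuousAt.eventually_mem ?_
    rw [hcι0]
    exact extChartAt_target_mem_nhds (I := 𝓡 3) p
  have hbox : ∀ᶠ z : ℝ × ℝ × ℝ in 𝓝 0, f z.1 (σ z.2) ∈ φ.source := by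
    have h1 := eventually_flow_mem_source f (p := p) (θ := 0) (by simp)
    have h2 : Tendsto (fun z : ℝ × ℝ × ℝ => (z.1, c₀ + ι z.2)) (𝓝 0) (𝓝 (0, c₀)) := by
      have : Continuous fun z : ℝ × ℝ × ℝ => (z.1, c₀ + ι z.2) := by fun_prop
      simpa using this.tendsto 0
    exact h2.eventually h1
  have hret : ∀ᶠ y in 𝓝 (0 : ℝ × ℝ), f (θ - (E y).1) (σ y) = σ (E y).2 := by
    have h1 : ∀ᶠ y in 𝓝 (0 : ℝ × ℝ), f θ (σ y) ∈ φ.source := by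
      have h2 := eventually_flow_mem_source f (p := p) (θ := θ) (by simp [hθ])
      have h3 : Tendsto (fun y : ℝ × ℝ => (θ, c₀ + ι y)) (𝓝 0) (𝓝 (θ, c₀)) := by
        have : Continuous fun y : ℝ × ℝ => (θ, c₀ + ι y) := by fun_prop
        simpa using this.tendsto 0
      exact h3.eventually h2
    have h4 : ∀ᶠ y in 𝓝 (0 : ℝ × ℝ), F (E y) = flowInChart f p (θ, c₀ + ι y) := by
      have h5 : Tendsto (fun y => flowInChart f p (θ, c₀ + ι y)) (𝓝 0) (𝓝 c₀) := by
        have h6 : ContinuousAt (fun v => flowInChart f p (θ, v)) (c₀ + ι 0) := by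
          rw [hcι0]
          exact (hf.hasStrictFDerivAt_chart hθ).continuousAt
        have h7 := (ContinuousAt.comp (f := fun y => c₀ + ι y) h6 hcι.continuousAt).tendsto
        simp only [Function.comp_def, hcι0, hg0] at h7
        exact h7
      exact h5.eventually hright
    filter_upwards [h1, h4, hEt.eventually hbox] with y hy1 hy2 hy3
    have hy4 : f (E y).1 (σ (E y).2) = f θ (σ y) := φ.injOn hy3 hy1 hy2
    rw [sub_eq_neg_add, f.map_add, ← hy4, f.neg_map_map]
  have htime : ∀ᶠ y in 𝓝 (0 : ℝ × ℝ), θ / 2 ≤ θ - (E y).1 ∧ θ - (E y).1 ≤ 2 * θ := by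
    have h1 : Tendsto (fun y => θ - (E y).1) (𝓝 0) (𝓝 θ) := by
      simpa using tendsto_const_nhds.sub ((continuous_fst.tendsto _).comp hEt)
    exact (h1.eventually_const_le (by linarith)).and (h1.eventually_le_const (by linarith))
  obtain ⟨ε, hε, hεinj⟩ := Metric.eventually_nhds_iff.1 hleft
  obtain ⟨r, hr, hrall⟩ := Metric.eventually_nhds_iff.1 ((hσc.and hret).and htime)
  have hr' := lt_min hr hε
  have hall : ∀ y : ℝ × ℝ, ‖y‖ < min r ε → _ := fun y hy =>
    hrall (y := y) (by simpa using hy.trans_le (min_le_left _ _))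
  refine ⟨σ, fun y => (E y).2, fun y => θ - (E y).1, min r ε, ?_, hGder⟩
  refine ⟨hr', hθ0, hσ0, ?_, by simp [hE0], fun y hy => (hall y hy).1.2,
    fun y hy => (hall y hy).2.1, fun y hy => (hall y hy).2.2, ?_, ε, hε, ?_⟩
  · refine (continuousOn_extChartAt_symm p).comp hcι.continuousOn fun y hy => ?_
    exact (hall y (mem_ball_zero_iff.1 hy)).1.1
  · intro ε' hε' ρ hρ
    have hφ : Tendsto φ (𝓝 p) (𝓝 c₀) := continuousAt_extChartAt p
    have hinvt : Tendsto inv (𝓝 c₀) (𝓝 0) := hinv0 ▸ hinv.continuousAt.tendsto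
    have hit := hinvt.comp hφ
    have hsmall : ∀ᶠ z : ℝ × ℝ × ℝ in 𝓝 0, |z.1| < ε' ∧ ‖z.2‖ < ρ := by
      have h1 : Tendsto (fun z : ℝ × ℝ × ℝ => |z.1|) (𝓝 0) (𝓝 0) := by
        simpa using (by fun_prop : Continuous fun z : ℝ × ℝ × ℝ => |z.1|).tendsto 0
      have h2 : Tendsto (fun z : ℝ × ℝ × ℝ => ‖z.2‖) (𝓝 0) (𝓝 0) := by
        simpa using (by fun_prop : Continuous fun z : ℝ × ℝ × ℝ => ‖z.2‖).tendsto 0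
      exact (h1.eventually_lt_const hε').and (h2.eventually_lt_const hρ)
    filter_upwards [hφ.eventually hright, hit.eventually hbox, hit.eventually hsmall,
      extChartAt_source_mem_nhds (I := 𝓡 3) p] with x h1 h2 h3 h4
    exact ⟨(inv (φ x)).1, (inv (φ x)).2, h3.1, h3.2, φ.injOn h2 h4 h1⟩
  · intro t y ht hy hty
    -- Both `(t, 0)` and `(0, y)` are flow-box coordinates of the same point and lie where the flow
    -- box is injective.
    have h1 : F (t, 0) = F (0, y) := by
      rw [hFσ, hFσ, hσ0, f.map_zero_apply, hty]
    have h2 : inv (F (t, 0)) = (t, 0) := hεinj (by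
      rw [dist_zero_right, Prod.norm_def]
      exact max_lt ht (by simpa using hε))
    have h3 : inv (F (0, y)) = (0, y) := hεinj (by
      rw [dist_zero_right, Prod.norm_def]
      exact max_lt (by simpa using hε) (hy.trans_le (min_le_right _ _)))
    rw [h1, h3] at h2
    exact (Prod.mk.inj h2).2

end SectionConstruction

/-! ### Contracting powers from spectral bounds -/

section PlanarLinearAlgebra

attribute [local instance] Matrix.linftyOpNormedRing Matrix.linftyOpNormedAlgebra in
/-- Powers of a complex matrix with spectrum in the open unit disc tend to zero. -/
theorem Matrix.tendsto_pow_of_spectrum_lt_one {n : Type*} [Fintype n] [DecidableEq n] [Nonempty n]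
    (A : Matrix n n ℂ) (hA : ∀ z ∈ spectrum ℂ A, ‖z‖ < 1) (i j : n) :
    Tendsto (fun k : ℕ => (A ^ k) i j) atTop (𝓝 0) := by
  have hρ : spectralRadius ℂ A < (1 : NNReal) :=
    spectrum.spectralRadius_lt_of_forall_lt A fun z hz => by exact_mod_cast hA z hz
  -- By Gelfand's formula, the norm of `A ^ k` is eventually less than `s ^ k` for some `s < 1`.
  obtain ⟨s, hs1, hs2⟩ := ENNReal.lt_iff_exists_nnreal_btwn.1 hρ
  have hs2' : s < 1 := by exact_mod_cast hs2
  have hev := (spectrum.pow_nnnorm_pow_one_div_tendsto_nhds_spectralRadius A).eventually_lt_const hs1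
  have hlim : Tendsto (fun k : ℕ => A ^ k) atTop (𝓝 0) := by
    refine squeeze_zero_norm' ?_ (tendsto_pow_atTop_nhds_zero_of_lt_one s.coe_nonneg
      (by exact_mod_cast hs2'))
    filter_upwards [hev, eventually_ge_atTop 1] with k hk hk1
    have hk0 : (0 : ℝ) < k := by exact_mod_cast hk1
    have h2 := ENNReal.rpow_le_rpow hk.le hk0.le
    rw [← ENNReal.rpow_mul, one_div, inv_mul_cancel₀ hk0.ne', ENNReal.rpow_one,
      ENNReal.rpow_natCast] at h2
    exact_mod_cast h2
  exact ((continuous_apply j).comp (continuous_apply i)).tendsto' _ _ rfl |>.comp hlim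

/-- A real matrix with complex spectrum in the open unit disc has a strongly contracting power. -/
theorem exists_pow_contracting {C : ℝ × ℝ →ₗ[ℝ] ℝ × ℝ}
    (hC : ∀ z ∈ spectrum ℂ ((LinearMap.toMatrix (Module.Basis.finTwoProd ℝ)
      (Module.Basis.finTwoProd ℝ) C).map (algebraMap ℝ ℂ)), ‖z‖ < 1) :
    ∃ k : ℕ, 1 ≤ k ∧ ∀ y, ‖(C ^ k) y‖ ≤ ‖y‖ / 4 := by
  set b := Module.Basis.finTwoProd ℝ
  set N := LinearMap.toMatrix b b C
  -- Two entries per row, each below `1 / 8`, give the factor `1 / 4` in the sup norm.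
  have hsmall : ∀ i j, ∀ᶠ k : ℕ in atTop, |(N ^ k) i j| < 1 / 8 := by
    intro i j
    have h1 := (Matrix.tendsto_pow_of_spectrum_lt_one _ hC i j).norm
    rw [norm_zero] at h1
    filter_upwards [h1.eventually_lt_const (by norm_num : (0 : ℝ) < 1 / 8)] with k hk
    rw [← Matrix.map_pow, Matrix.map_apply] at hk
    simpa using hk
  obtain ⟨k, ⟨⟨⟨h00, h01⟩, h10⟩, h11⟩, hk⟩ :=
    ((((hsmall 0 0).and (hsmall 0 1)).and (hsmall 1 0)).and (hsmall 1 1)).and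
      (eventually_ge_atTop 1) |>.exists
  refine ⟨k, hk, fun y => ?_⟩
  have hrep : ∀ i, b.repr ((C ^ k) y) i = (N ^ k) i 0 * y.1 + (N ^ k) i 1 * y.2 := by
    intro i
    have h1 := congrFun (LinearMap.toMatrix_mulVec_repr b b (C ^ k) y) i
    rw [← h1, LinearMap.toMatrix_pow]
    simp [Matrix.mulVec, dotProduct, Fin.sum_univ_two, b]
  have h0 := hrep 0
  have h1 := hrep 1
  simp only [b, Module.Basis.coe_finTwoProd_repr] at h0 h1
  simp only [Matrix.cons_val_zero, Matrix.cons_val_one] at h0 h1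
  have hy1 : |y.1| ≤ ‖y‖ := norm_fst_le y
  have hy2 : |y.2| ≤ ‖y‖ := norm_snd_le y
  have hbd : ∀ u v : ℝ, |u| < 1 / 8 → |v| < 1 / 8 → |u * y.1 + v * y.2| ≤ ‖y‖ / 4 := by
    intro u v hu hv
    refine (abs_add_le _ _).trans ?_
    rw [abs_mul, abs_mul]
    have h3 : |u| * |y.1| ≤ 1 / 8 * ‖y‖ := mul_le_mul hu.le hy1 (abs_nonneg _) (by norm_num)
    have h4 : |v| * |y.2| ≤ 1 / 8 * ‖y‖ := mul_le_mul hv.le hy2 (abs_nonneg _) (by norm_num)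
    linarith
  rw [Prod.norm_def, Real.norm_eq_abs, Real.norm_eq_abs, h0, h1]
  exact max_le (hbd _ _ h00 h01) (hbd _ _ h10 h11)

/-- A real planar map with complex spectrum outside the closed unit disc has an inverse with a
strongly contracting power. -/
theorem exists_inverse_pow_contracting {C : ℝ × ℝ →ₗ[ℝ] ℝ × ℝ}
    (hC : ∀ z ∈ spectrum ℂ ((LinearMap.toMatrix (Module.Basis.finTwoProd ℝ)
      (Module.Basis.finTwoProd ℝ) C).map (algebraMap ℝ ℂ)), 1 < ‖z‖) :
    ∃ (C' : ℝ × ℝ →ₗ[ℝ] ℝ × ℝ) (k : ℕ), (∀ y, C (C' y) = y) ∧ 1 ≤ k ∧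
      ∀ y, ‖(C' ^ k) y‖ ≤ ‖y‖ / 4 := by
  set b := Module.Basis.finTwoProd ℝ
  set N := LinearMap.toMatrix b b C
  have hunitC : IsUnit (N.map (algebraMap ℝ ℂ)) := by
    rw [← spectrum.zero_notMem_iff ℂ]
    intro h0
    have := hC 0 h0
    rw [norm_zero] at this
    linarith
  have hdet : IsUnit N.det := by
    rw [Matrix.isUnit_iff_isUnit_det] at hunitC
    have e : (N.map (algebraMap ℝ ℂ)).det = algebraMap ℝ ℂ N.det :=
      ((algebraMap ℝ ℂ).map_det N).symm
    rw [e, isUnit_iff_ne_zero] at hunitC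
    exact isUnit_iff_ne_zero.2 fun h0 => hunitC (by rw [h0, map_zero])
  have hmul : N * N⁻¹ = 1 := Matrix.mul_nonsing_inv N hdet
  have hmul' : N⁻¹ * N = 1 := Matrix.nonsing_inv_mul N hdet
  let C' := Matrix.toLin b b N⁻¹
  have hC' : LinearMap.toMatrix b b C' = N⁻¹ := LinearMap.toMatrix_toLin b b _
  obtain ⟨k, hk, hk'⟩ := exists_pow_contracting (C := C') (by
    intro z hz
    rw [hC'] at hz
    let u : (Matrix (Fin 2) (Fin 2) ℂ)ˣ := ⟨N.map (algebraMap ℝ ℂ), N⁻¹.map (algebraMap ℝ ℂ),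
      by rw [← Matrix.map_mul, hmul, Matrix.map_one _ (map_zero _) (map_one _)],
      by rw [← Matrix.map_mul, hmul', Matrix.map_one _ (map_zero _) (map_one _)]⟩
    have hz0 : z ≠ 0 := by
      rintro rfl
      exact (spectrum.zero_notMem_iff ℂ).2 u⁻¹.isUnit hz
    -- The spectrum of the inverse consists of the inverses, which turns expansion of `C` into
    -- contraction of `C'`.
    have h1 : z⁻¹ ∈ spectrum ℂ (u : Matrix (Fin 2) (Fin 2) ℂ) := by
      have := (spectrum.inv_mem_iff (r := Units.mk0 z⁻¹ (inv_ne_zero hz0)) (a := u)).2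
      rw [Units.val_inv_eq_inv_val, Units.val_mk0, inv_inv] at this
      exact this hz
    have h2 := hC _ h1
    rw [norm_inv] at h2
    exact (one_lt_inv₀ (norm_pos_iff.2 hz0)).1 h2)
  refine ⟨C', k, fun y => ?_, hk, hk'⟩
  have h1 : C ∘ₗ C' = LinearMap.id := by
    apply (LinearMap.toMatrix b b).injective
    rw [LinearMap.toMatrix_comp b b b, hC', LinearMap.toMatrix_id]
    exact hmul
  exact LinearMap.congr_fun h1 y

end PlanarLinearAlgebra

/-! ### The linear return map modulo the flow direction -/

section Transverse

/-- A linear map fixing `X ≠ 0` induces a planar map modulo `X`, whose complex spectrum consists of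
the eigenvalues of the map with `1` removed once. -/
theorem exists_transverse {L : E3 →ₗ[ℝ] E3} {X : E3} (hX : X ≠ 0) (hLX : L X = X) :
    ∃ (ι : ℝ × ℝ →L[ℝ] E3) (C : ℝ × ℝ →ₗ[ℝ] ℝ × ℝ),
      (∀ (t : ℝ) y, t • X + ι y = 0 → t = 0 ∧ y = 0) ∧
      (∀ y, ∃ c : ℝ, L (ι y) = c • X + ι (C y)) ∧
      ∀ z ∈ spectrum ℂ ((LinearMap.toMatrix (Module.Basis.finTwoProd ℝ)
        (Module.Basis.finTwoProd ℝ) C).map (algebraMap ℝ ℂ)),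
        z ∈ ((L.charpoly.map (algebraMap ℝ ℂ)).roots).erase 1 := by
  obtain ⟨q, hq⟩ := Submodule.exists_isCompl (Submodule.span ℝ {X})
  have hfin : Module.finrank ℝ q = 2 := by
    have h1 := Submodule.finrank_add_eq_of_isCompl hq
    rw [finrank_span_singleton hX] at h1
    simp only [finrank_euclideanSpace, Fintype.card_fin] at h1
    omega
  let e : (ℝ × ℝ) ≃ₗ[ℝ] q := LinearEquiv.ofFinrankEq _ _ (by simp [hfin])
  let ι₀ : ℝ × ℝ →ₗ[ℝ] E3 := q.subtype ∘ₗ e.toLinearMap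
  have hι : ∀ (t : ℝ) y, t • X + ι₀ y = 0 → t = 0 ∧ y = 0 := by
    intro t y h
    have h1 : ι₀ y ∈ Submodule.span ℝ {X} := by
      rw [eq_neg_of_add_eq_zero_right h]
      exact neg_mem (Submodule.smul_mem _ _ (Submodule.mem_span_singleton_self X))
    have h2 : ι₀ y = 0 := by
      have := hq.disjoint.le_bot ⟨h1, (e y).2⟩
      simpa using this
    rw [h2, add_zero] at h
    refine ⟨(smul_eq_zero.1 h).resolve_right hX, ?_⟩
    have h3 : e y = 0 := Subtype.ext h2
    simpa using h3
  let Ψ₀ : (ℝ × ℝ × ℝ) →ₗ[ℝ] E3 := (LinearMap.toSpanSingleton ℝ E3 X).coprod ι₀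
  have hΨ₀ : Function.Injective Ψ₀ := by
    rw [injective_iff_map_eq_zero]
    rintro ⟨t, y⟩ hty
    obtain ⟨rfl, rfl⟩ := hι t y hty
    rfl
  let Ψ : (ℝ × ℝ × ℝ) ≃ₗ[ℝ] E3 := LinearEquiv.ofInjectiveOfFinrankEq Ψ₀ hΨ₀ (by simp)
  have hΨ : ∀ t y, Ψ (t, y) = t • X + ι₀ y := fun t y => rfl
  have hΨX : Ψ (1, 0) = X := by rw [hΨ]; simp
  have hΨι : ∀ y, Ψ (0, y) = ι₀ y := fun y => by rw [hΨ]; simp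
  let C : ℝ × ℝ →ₗ[ℝ] ℝ × ℝ := LinearMap.snd ℝ ℝ (ℝ × ℝ) ∘ₗ Ψ.symm.toLinearMap ∘ₗ L ∘ₗ ι₀
  refine ⟨ι₀.toContinuousLinearMap, C, hι, fun y => ⟨(Ψ.symm (L (ι₀ y))).1, ?_⟩, ?_⟩
  · have h1 := Ψ.apply_symm_apply (L (ι₀ y))
    exact h1.symm
  set b := Module.Basis.finTwoProd ℝ
  set N := LinearMap.toMatrix b b C
  let b₁ : Module.Basis Unit ℝ ℝ := Module.Basis.singleton Unit ℝ
  let B := (b₁.prod b).map Ψ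
  -- In a basis starting with `X` the matrix is block triangular with the block `1` in the corner,
  -- so the characteristic polynomial splits off exactly one factor `X - 1`.
  have hmat : LinearMap.toMatrix B B L = Matrix.fromBlocks 1
      (Matrix.of fun _ j => (Ψ.symm (L (ι₀ (b j)))).1) 0 N := by
    ext i j
    rw [LinearMap.toMatrix_apply]
    rcases j with j | j
    · have h1 : B (Sum.inl j) = X := by simp [B, b₁, hΨX]
      have h2 : Ψ.symm X = (1, 0) := by rw [← hΨX, Ψ.symm_apply_apply]
      rw [h1, hLX]
      rcases i with i | i
      · simp [B, b₁, h2]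
      · simp [B, h2]
    · have h1 : B (Sum.inr j) = ι₀ (b j) := by simp [B, hΨι]
      rw [h1]
      rcases i with i | i
      · simp [B, b₁]
      · have hN : N i j = b.repr (C (b j)) i := LinearMap.toMatrix_apply b b C i j
        rw [Matrix.fromBlocks_apply₂₂, hN]
        simp [B, C]
  have hchar : L.charpoly = (Polynomial.X - Polynomial.C 1) * N.charpoly := by
    rw [← LinearMap.charpoly_toMatrix L B, hmat, Matrix.charpoly_fromBlocks_zero₂₁]
    simp [Matrix.charpoly, Matrix.charmatrix]
  intro z hz
  rw [Matrix.mem_spectrum_iff_isRoot_charpoly, Matrix.charpoly_map] at hz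
  have hne : N.charpoly.map (algebraMap ℝ ℂ) ≠ 0 :=
    ((Matrix.charpoly_monic N).map _).ne_zero
  rw [hchar, Polynomial.map_mul, Polynomial.roots_mul
    (mul_ne_zero (by simpa using Polynomial.X_sub_C_ne_zero (1 : ℂ)) hne)]
  have h1 : ((Polynomial.X - Polynomial.C (1 : ℝ)).map (algebraMap ℝ ℂ)).roots = {1} := by
    rw [Polynomial.map_sub, Polynomial.map_X, Polynomial.map_C, map_one,
      Polynomial.roots_X_sub_C]
  rw [h1, Multiset.singleton_add, Multiset.erase_cons_head]
  exact (Polynomial.mem_roots hne).2 hz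

/-- Real multipliers different from one have real eigenvectors. -/
theorem exists_eigenvector_of_mem_multipliers {L : E3 →ₗ[ℝ] E3} {z : ℂ}
    (hz : z ∈ ((L.charpoly.map (algebraMap ℝ ℂ)).roots).erase 1) (him : z.im = 0) :
    ∃ v : E3, v ≠ 0 ∧ L v = z.re • v := by
  have h1 := Polynomial.isRoot_of_mem_roots (Multiset.mem_of_mem_erase hz)
  have h2 : z = algebraMap ℝ ℂ z.re := by
    apply Complex.ext <;> simp [him]
  rw [h2] at h1
  have h3 : L.charpoly.IsRoot z.re := h1.of_map (algebraMap ℝ ℂ).injective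
  obtain ⟨v, hv⟩ := ((Module.End.hasEigenvalue_iff_isRoot_charpoly L z.re).2 h3).exists_hasEigenvector
  exact ⟨v, hv.2, hv.apply_eq_smul⟩

end Transverse

end

/-! ### From multipliers to dynamics -/

section Assembly

variable {M : Type*} [TopologicalSpace M] [ChartedSpace E3 M] [IsManifold (𝓡 3) 1 M]
  {f : Flow ℝ M} {P : Set (Set M)} {O : Set M} {p : M} {T : ℝ}

/-- A periodic orbit whose transverse linear return map is contracting has a section with
contracting return map. -/
theorem IsC1Flow.exists_contracting_section (hf : IsC1Flow f) (hO : IsPeriodicOrbitAt f O p T)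
    {ι : ℝ × ℝ →L[ℝ] E3} {C : ℝ × ℝ →ₗ[ℝ] ℝ × ℝ} {k : ℕ}
    (hι : ∀ (t : ℝ) y, t • velocity f p + ι y = 0 → t = 0 ∧ y = 0)
    (hC : ∀ y, ∃ c : ℝ, chartDifferential f p T (ι y) = c • velocity f p + ι (C y))
    (hk : 1 ≤ k) (hCk : ∀ y, ‖(C ^ k) y‖ ≤ ‖y‖ / 4) :
    ∃ θ σ G τ r, IsFlowSection f p θ σ G τ r ∧ ∀ y, ‖y‖ < r → ‖G y‖ ≤ ‖y‖ / 2 := by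
  have hCn : ∀ (n : ℕ) y, ∃ c : ℝ,
      (chartDifferential f p T ^ n) (ι y) = c • velocity f p + ι ((C ^ n) y) := by
    intro n
    induction n with
    | zero => exact fun y => ⟨0, by simp⟩
    | succ n ih =>
      intro y
      obtain ⟨c, hc⟩ := ih y
      obtain ⟨c', hc'⟩ := hC ((C ^ n) y)
      refine ⟨c + c', ?_⟩
      rw [pow_succ', pow_succ', mul_apply_eq_comp, hc, map_add, map_smul,
        hf.chartDifferential_velocity hO.map_period, hc', Module.End.mul_apply, add_smul, add_assoc]
  have hk0 : (0 : ℝ) < k := by exact_mod_cast hk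
  -- The section is taken with return time near `k * T`, so that the derivative of its return map is
  -- the contracting power `C ^ k` in place of `C`.
  obtain ⟨σ, G, τ, r, hsec, hG⟩ := hf.exists_flowSection (mul_pos hk0 hO.pos)
    (flow_nat_mul_period hO.map_period k) hι (B := (C ^ k).toContinuousLinearMap) (by
      intro y
      rw [hf.chartDifferential_nat_mul hO.map_period]
      exact hCn k y)
  -- The linear part contributes `1 / 4` and the remainder another `1 / 4`, which gives the factor
  -- `1 / 2`.
  have hev := hG.hasFDerivAt.isLittleO.def (by norm_num : (0 : ℝ) < 1 / 4)
  obtain ⟨ρ, hρ, hρG⟩ := Metric.eventually_nhds_iff.1 hev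
  have hρ' := lt_min hρ hsec.r_pos
  refine ⟨_, σ, G, τ, _, hsec.congr_of_le hρ' (min_le_right _ _) fun _ _ => rfl, fun y hy => ?_⟩
  have h1 := hρG (y := y) (by simpa using hy.trans_le (min_le_left _ _))
  rw [hsec.map_zero, sub_zero, sub_zero] at h1
  have h2 := hCk y
  have h3 := norm_le_norm_add_norm_sub' (G y) ((C ^ k) y)
  have h4 : ‖G y - (C ^ k) y‖ ≤ 1 / 4 * ‖y‖ := h1
  linarith

/-- The dynamical properties of an attracting periodic orbit used below. -/
structure IsStableOrbit (f : Flow ℝ M) (O : Set M) : Prop where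
  isOpen : IsOpen (stableManifold f O)
  reverse_subset : stableManifold f.reverse O ⊆ O
  isolating : HasIsolatingSection f.reverse O

variable [T2Space M] [CompactSpace M]

omit [ChartedSpace E3 M] [IsManifold (𝓡 3) 1 M] in
theorem IsFlowSection.isStableOrbit {θ : ℝ} {σ : ℝ × ℝ → M} {G : ℝ × ℝ → ℝ × ℝ}
    {τ : ℝ × ℝ → ℝ} {r : ℝ} (h : IsFlowSection f p θ σ G τ r) (hd : IsOrbitDecomposition f P)
    (hO : IsPeriodicOrbitAt f O p T) (hG : ∀ y, ‖y‖ < r → ‖G y‖ ≤ ‖y‖ / 2) :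
    IsStableOrbit f O := by
  obtain ⟨h1, h2⟩ := h.asymptoticallyStable hd hO hG
  rw [← f.reverse_reverse] at h h2
  exact ⟨hO.isOpen_stableManifold h1, stableManifold_subset_of_reverse_stable hO.reverse h2,
    h.hasIsolatingSection_of_reverse hd.reverse hO.reverse⟩

theorem IsC1Flow.isStableOrbit_of_multipliers_lt (hf : IsC1Flow f) (hd : IsOrbitDecomposition f P)
    (hO : IsPeriodicOrbitAt f O p T) (hm : ∀ z ∈ multipliers f p T, ‖z‖ < 1) :
    IsStableOrbit f O := by
  have hX := hf.chartDifferential_velocity hO.map_period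
  obtain ⟨ι, C, hι, hC, hspec⟩ := exists_transverse (L := (chartDifferential f p T).toLinearMap)
    (hf.velocity_ne_zero hO) hX
  rw [hf.toLinearMap_chartDifferential hO.map_period] at hspec
  obtain ⟨k, hk, hCk⟩ := exists_pow_contracting fun z hz => hm z (hspec z hz)
  obtain ⟨θ, σ, G, τ, r, hsec, hG⟩ := hf.exists_contracting_section hO hι hC hk hCk
  exact hsec.isStableOrbit hd hO hG

/-- The inverse `C'` of the transverse map represents the differential of the reversed flow modulo
its direction, with the same `ι`, and has a contracting power. -/
theorem IsC1Flow.isStableOrbit_reverse_of_lt_multipliers (hf : IsC1Flow f)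
    (hd : IsOrbitDecomposition f P) (hO : IsPeriodicOrbitAt f O p T)
    (hm : ∀ z ∈ multipliers f p T, 1 < ‖z‖) : IsStableOrbit f.reverse O := by
  have hX := hf.chartDifferential_velocity hO.map_period
  have hneg := hf.chartDifferential_neg_apply hO.map_period
  obtain ⟨ι, C, hι, hC, hspec⟩ := exists_transverse (L := (chartDifferential f p T).toLinearMap)
    (hf.velocity_ne_zero hO) hX
  rw [hf.toLinearMap_chartDifferential hO.map_period] at hspec
  obtain ⟨C', k, hCC', hk, hCk⟩ := exists_inverse_pow_contracting fun z hz => hm z (hspec z hz)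
  obtain ⟨θ, σ, G, τ, r, hsec, hG⟩ := hf.reverse.exists_contracting_section hO.reverse (ι := ι)
    (C := C') (by
      intro t y h
      rw [hf.velocity_reverse, smul_neg, ← neg_smul] at h
      obtain ⟨h1, h2⟩ := hι _ _ h
      exact ⟨neg_eq_zero.1 h1, h2⟩) (by
      intro y
      obtain ⟨c, hc⟩ := hC (C' y)
      rw [hCC'] at hc
      refine ⟨c, ?_⟩
      have h1 := congrArg (chartDifferential f p (-T)) hc
      have h2 := hneg (velocity f p)
      rw [hX] at h2
      rw [ContinuousLinearMap.coe_coe, hneg, map_add, map_smul, h2] at h1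
      rw [chartDifferential_reverse, hf.velocity_reverse, h1, smul_neg]
      abel) hk hCk
  exact hsec.isStableOrbit hd.reverse hO.reverse hG

/-- `O` is a saddle orbit with negative multipliers. -/
def IsFlipSaddleOrbit (f : Flow ℝ M) (O : Set M) : Prop :=
  ∃ (p : M) (T : ℝ) (a b : ℝ) (v w : E3), IsPeriodicOrbitAt f O p T ∧ -1 < a ∧ a < 0 ∧ b < -1 ∧
    v ≠ 0 ∧ w ≠ 0 ∧ chartDifferential f p T v = a • v ∧ chartDifferential f p T w = b • w

-- The eigenvectors persist and the eigenvalues are inverted, so the contracting and expanding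
-- directions are exchanged and both signs remain negative.
omit [T2Space M] [CompactSpace M] in
theorem IsFlipSaddleOrbit.reverse (hf : IsC1Flow f) (h : IsFlipSaddleOrbit f O) :
    IsFlipSaddleOrbit f.reverse O := by
  obtain ⟨p, T, a, b, v, w, hO, ha, ha', hb, hv, hw, hLv, hLw⟩ := h
  have key : ∀ (c : ℝ) (u : E3), c ≠ 0 → chartDifferential f p T u = c • u →
      chartDifferential f.reverse p T u = c⁻¹ • u := by
    intro c u hc hu
    have h1 := hf.chartDifferential_neg_apply hO.map_period u
    rw [hu, map_smul] at h1
    rw [chartDifferential_reverse, eq_inv_smul_iff₀ hc, h1]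
  refine ⟨p, T, b⁻¹, a⁻¹, w, v, hO.reverse, ?_, ?_, ?_, hw, hv, key b w (by linarith) hLw,
    key a v ha'.ne hLv⟩
  · rw [← inv_neg_one]
    exact (inv_lt_inv_of_neg (by norm_num) (by linarith)).2 hb
  · exact inv_lt_zero.2 (by linarith)
  · rw [← inv_neg_one]
    exact (inv_lt_inv_of_neg ha' (by norm_num)).2 ha

omit [T2Space M] [CompactSpace M] in
theorem IsC1Flow.isFlipSaddleOrbit_of_twisted (hf : IsC1Flow f) (h : IsTwistedSaddleOrbit f O) :
    IsFlipSaddleOrbit f O := by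
  obtain ⟨p, T, hO, ⟨z, hz, hz1⟩, ⟨z', hz', hz'1⟩, hneg⟩ := h
  have key : ∀ z : ℂ, z.im = 0 → z.re < 0 → ‖z‖ = -z.re := by
    intro z h1 h2
    have h3 : z = (z.re : ℂ) := by apply Complex.ext <;> simp [h1]
    rw [h3, Complex.norm_real, Real.norm_eq_abs, Complex.ofReal_re, abs_of_neg h2]
  obtain ⟨him, hre⟩ := hneg z hz
  obtain ⟨him', hre'⟩ := hneg z' hz'
  rw [key z him hre] at hz1
  rw [key z' him' hre'] at hz'1
  obtain ⟨v, hv, hLv⟩ := exists_eigenvector_of_mem_multipliers hz him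
  obtain ⟨w, hw, hLw⟩ := exists_eigenvector_of_mem_multipliers hz' him'
  rw [← hf.toLinearMap_chartDifferential hO.map_period] at hLv hLw
  exact ⟨p, T, z.re, z'.re, v, w, hO, by linarith, hre, by linarith, hv, hw, hLv, hLw⟩

/-- Applying `L - 1` removes `X`, and then `L - b` removes `w`; the surviving coefficient of `v`
must vanish, then that of `w`, then that of `X`. -/
theorem eigenvectors_independent {L : E3 →L[ℝ] E3} {X v w : E3} {a b : ℝ} (hX : X ≠ 0) (hv : v ≠ 0)
    (hw : w ≠ 0) (hLX : L X = X) (hLv : L v = a • v) (hLw : L w = b • w) (ha : a ≠ 1) (hb : b ≠ 1)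
    (hab : a ≠ b) {t x y : ℝ} (h : t • X + (x • v + y • w) = 0) : t = 0 ∧ x = 0 ∧ y = 0 := by
  have h1 := congrArg L h
  simp only [map_add, map_smul, map_zero, hLX, hLv, hLw] at h1
  have h2 : (x * (a - 1)) • v + (y * (b - 1)) • w = 0 := by
    have : (x * (a - 1)) • v + (y * (b - 1)) • w =
        (t • X + (x • a • v + y • b • w)) - (t • X + (x • v + y • w)) := by module
    rw [this, h1, h, sub_zero]
  have h3 := congrArg L h2
  simp only [map_add, map_smul, map_zero, hLv, hLw] at h3
  have h4 : (x * (a - 1) * (a - b)) • v = 0 := by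
    have : (x * (a - 1) * (a - b)) • v = ((x * (a - 1)) • a • v + (y * (b - 1)) • b • w) -
        b • ((x * (a - 1)) • v + (y * (b - 1)) • w) := by module
    rw [this, h3, h2, smul_zero, sub_zero]
  have hx : x = 0 := by
    have h5 := (smul_eq_zero.1 h4).resolve_right hv
    have h6 := (mul_eq_zero.1 h5).resolve_right (sub_ne_zero.2 hab)
    exact (mul_eq_zero.1 h6).resolve_right (sub_ne_zero.2 ha)
  subst hx
  rw [zero_mul, zero_smul, zero_add] at h2
  have hy : y = 0 :=
    (mul_eq_zero.1 ((smul_eq_zero.1 h2).resolve_right hw)).resolve_right (sub_ne_zero.2 hb)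
  subst hy
  rw [zero_smul, zero_smul, add_zero, add_zero] at h
  exact ⟨(smul_eq_zero.1 h).resolve_right hX, rfl, rfl⟩

/-- A section spanned by the two eigenvectors has a return map with derivative `diag(a, b)`. Near
`0` this map agrees with a global flip saddle `H`, which replaces it on a smaller section that is
also isolating. -/
theorem IsC1Flow.exists_basin_of_isFlipSaddleOrbit (hf : IsC1Flow f) {S : Set M}
    (hd : IsOrbitDecomposition f P) (hS : IsFlipSaddleOrbit f S) {sinks : Set (Set M)}
    (hsinks : ∀ O ∈ sinks, IsOpen (stableManifold f O))
    (hother : ∀ O ∈ P, O ≠ S → O ∈ sinks ∨ stableManifold f O ⊆ O) :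
    ∃ p T, IsPeriodicOrbitAt f S p T ∧
      ∃ A ∈ sinks, A ∈ P ∧ stableManifold f S ∪ stableManifold f A ∈ 𝓝 p := by
  obtain ⟨p, T, a, b, v, w, hO, ha, ha', hb, hv, hw, hLv, hLw⟩ := hS
  refine ⟨p, T, hO, ?_⟩
  let ι : ℝ × ℝ →L[ℝ] E3 := ((LinearMap.toSpanSingleton ℝ E3 v).coprod
    (LinearMap.toSpanSingleton ℝ E3 w)).toContinuousLinearMap
  have hι : ∀ y : ℝ × ℝ, ι y = y.1 • v + y.2 • w := fun y => rfl
  let B : ℝ × ℝ →L[ℝ] ℝ × ℝ := (a • LinearMap.fst ℝ ℝ ℝ).prod (b • LinearMap.snd ℝ ℝ ℝ)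
    |>.toContinuousLinearMap
  have hB : ∀ y : ℝ × ℝ, B y = (a * y.1, b * y.2) := fun y => rfl
  obtain ⟨σ, G, τ, r, hsec, hG⟩ := hf.exists_flowSection hO.pos hO.map_period (ι := ι) (B := B)
    (by
      rintro t ⟨x, y⟩ h
      obtain ⟨h1, h2, h3⟩ := eigenvectors_independent (hf.velocity_ne_zero hO) hv hw
        (hf.chartDifferential_velocity hO.map_period) hLv hLw (by linarith) (by linarith)
        (by linarith) (t := t) (x := x) (y := y) h
      exact ⟨h1, by rw [h2, h3]; rfl⟩)
    (fun y => ⟨0, by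
      rw [hι, map_add, map_smul, map_smul, hLv, hLw, hι, hB, zero_smul, zero_add, smul_smul,
        smul_smul, mul_comm a, mul_comm b]⟩)
  obtain ⟨H, l, m, K, δ, hH, hδ, hHG⟩ := exists_flipSaddle_extension hG hsec.map_zero hB
    (abs_lt.2 ⟨ha, by linarith⟩) hb
  obtain ⟨ρ, hρ, hρr, hiso⟩ := hsec.exists_isolating hd hO
  have hsec' := hsec.congr_of_le (lt_min hδ hρ) ((min_le_right _ _).trans hρr)
    fun y hy => hHG y (hy.le.trans (min_le_left _ _))
  exact hsec'.exists_unique_basin hH hO hd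
    (fun y hy => hiso y (hy.trans_le (min_le_right _ _))) hsinks hother

/-- Stated for arbitrary families of sinks and sources with symmetric hypotheses, so that it applies
both to `f` and to the reversed flow. -/
theorem IsC1Flow.exists_sinks_eq_singleton [ConnectedSpace M] (hf : IsC1Flow f) {S : Set M}
    (hd : IsOrbitDecomposition f P) (hS : IsFlipSaddleOrbit f S) {sinks sources : Set (Set M)}
    (hP : P = insert S (sinks ∪ sources)) (hSsinks : S ∉ sinks)
    (hsinks : ∀ O ∈ sinks, IsStableOrbit f O)
    (hsources : ∀ O ∈ sources, IsStableOrbit f.reverse O) : ∃ A, sinks = {A} := by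
  have hsources' : ∀ O ∈ sources, stableManifold f O ⊆ O ∧ HasIsolatingSection f O := by
    intro O hO
    have h1 := (hsources O hO).reverse_subset
    have h2 := (hsources O hO).isolating
    rw [f.reverse_reverse] at h1 h2
    exact ⟨h1, h2⟩
  obtain ⟨p, T, hp, A, hA, -, hSA⟩ := hf.exists_basin_of_isFlipSaddleOrbit hd hS
    (fun O hO => (hsinks O hO).isOpen) (by
      intro O hO hOS
      rw [hP] at hO
      rcases hO with hO | hO | hO
      · exact absurd hO hOS
      · exact Or.inl hO
      · exact Or.inr (hsources' O hO).1)
  exact ⟨A, hd.sinks_eq_singleton hp hP hSsinks (fun O hO => (hsinks O hO).isOpen) hsources' hA hSA⟩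

end Assembly

/-- The nonwandering set of a flow of class `G_3^-(M)` on a connected closed orientable 3-manifold
consists of exactly three periodic orbits: a saddle, an attracting and a repelling one. -/
theorem lemma1 {M : Type*} [TopologicalSpace M] [T2Space M] [CompactSpace M] [ConnectedSpace M]
    [ChartedSpace E3 M] [IsManifold (𝓡 3) 1 M] (hM : IsOrientable3 M)
    (f : Flow ℝ M) (hf : IsG3MinusFlow f) :
    ∃ S A R : Set M,
      IsSaddleOrbit f S ∧ IsAttractingOrbit f A ∧ IsRepellingOrbit f R ∧
      S ≠ A ∧ S ≠ R ∧ A ≠ R ∧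
      nonwanderingSet f = S ∪ A ∪ R ∧
      {O : Set M | IsPeriodicOrbit f O} = {S, A, R} := by
  obtain ⟨P, hPfin, hPhyp, hPΩ⟩ := hf.nms.finite_hyperbolic
  obtain ⟨S, hS, hSuniq⟩ := hf.unique_saddle
  have hC1 := hf.nms.contMDiff
  have hd : IsOrbitDecomposition f P := ⟨hPfin, fun O hO => by
    obtain ⟨p, T, h, -⟩ := hPhyp O hO
    exact ⟨p, T, h⟩, hPΩ⟩
  have hSP : S ∈ P := by
    obtain ⟨p, T, h, -⟩ := hS
    exact hd.mem_of_isPeriodicOrbit ⟨p, T, h⟩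
  have hSflip := hC1.isFlipSaddleOrbit_of_twisted (hf.twisted S hS)
  set sinks : Set (Set M) := {O | O ∈ P ∧ O ≠ S ∧ IsAttractingOrbit f O}
  -- Defining the sources by negation makes the partition of `P` and the relation `A ≠ R` immediate;
  -- that they are repelling follows from hyperbolicity and the uniqueness of the saddle.
  set sources : Set (Set M) := {O | O ∈ P ∧ O ≠ S ∧ ¬ IsAttractingOrbit f O}
  have hrep : ∀ O ∈ sources, IsRepellingOrbit f O := by
    rintro O ⟨hO, hOS, hnot⟩
    obtain ⟨p, T, hp, hne⟩ := hPhyp O hO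
    by_cases h1 : ∃ z ∈ multipliers f p T, ‖z‖ < 1
    · by_cases h2 : ∃ z ∈ multipliers f p T, 1 < ‖z‖
      · exact absurd (hSuniq O ⟨p, T, hp, h1, h2⟩) hOS
      · push Not at h2
        exact absurd ⟨p, T, hp, fun z hz => (h2 z hz).lt_of_ne (hne z hz)⟩ hnot
    · push Not at h1
      exact ⟨p, T, hp, fun z hz => (h1 z hz).lt_of_ne (hne z hz).symm⟩
  have hsinks : ∀ O ∈ sinks, IsStableOrbit f O := by
    rintro O ⟨-, -, p, T, hp, hm⟩
    exact hC1.isStableOrbit_of_multipliers_lt hd hp hm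
  have hsources : ∀ O ∈ sources, IsStableOrbit f.reverse O := by
    intro O hO
    obtain ⟨p, T, hp, hm⟩ := hrep O hO
    exact hC1.isStableOrbit_reverse_of_lt_multipliers hd hp hm
  have hPeq : P = insert S (sinks ∪ sources) := by
    ext O
    constructor
    · intro hO
      by_cases h1 : O = S
      · exact Or.inl h1
      · by_cases h2 : IsAttractingOrbit f O
        · exact Or.inr (Or.inl ⟨hO, h1, h2⟩)
        · exact Or.inr (Or.inr ⟨hO, h1, h2⟩)
    · rintro (rfl | hO | hO)
      · exact hSP
      · exact hO.1
      · exact hO.1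
  obtain ⟨A, hA⟩ := hC1.exists_sinks_eq_singleton hd hSflip hPeq (fun h => h.2.1 rfl) hsinks hsources
  -- The same argument for the reversed flow, with the roles of sinks and sources exchanged.
  obtain ⟨R, hR⟩ := hC1.reverse.exists_sinks_eq_singleton hd.reverse (hSflip.reverse hC1)
    (sinks := sources) (sources := sinks) (by rw [union_comm]; exact hPeq) (fun h => h.2.1 rfl)
    hsources (by rw [f.reverse_reverse]; exact hsinks)
  have hAmem : A ∈ sinks := hA ▸ mem_singleton A
  have hRmem : R ∈ sources := hR ▸ mem_singleton R
  have hP3 : P = {S, A, R} := by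
    rw [hPeq, hA, hR]
    rfl
  refine ⟨S, A, R, hS, hAmem.2.2, hrep R hRmem, hAmem.2.1.symm, hRmem.2.1.symm, ?_, ?_, ?_⟩
  · rintro rfl
    exact hRmem.2.2 hAmem.2.2
  · rw [hPΩ, hP3]
    simp [union_assoc]
  · rw [← hP3]
    ext O
    exact ⟨hd.mem_of_isPeriodicOrbit, hd.periodic O⟩
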